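/- Let $F=(f_1,f_2)$ be a pair of bivariate trinomials, i.e. each $f_i$ is a sum $\sum_{a\in A_i} c_a x^{a}$ of exactly three terms, with three distinct exponent vectors $a=(a_1,a_2)\in\mathbb{R}^2$ and nonzero real coefficients $c_a$, where $x^a=x_1^{a_1}x_2^{a_2}$. Let $\mathrm{Newt}(f_i)$ be the convex hull of the three exponent vectors of $f_i$, and let $P_F:=\mathrm{Newt}(f_1)+\mathrm{Newt}(f_2)$ (Minkowski sum). Call an arc any homeomorphic image of the unit circle or of a (closed, open or half-open, possibly one-point) interval, and call a root $\zeta$ of $F$ in the open positive quadrant $\mathbb{R}^2_+$ isolated if the only arc of roots of $F$ in $\mathbb{R}^2_+$ containing $\zeta$ is $\{\zeta\}$. Then: * if $P_F$ is a line segment, $F$ has no isolated root in $\mathbb{R}^2_+$; * if $P_F$ is a triangle, $F$ has at most $2$ isolated roots in $\mathbb{R}^2_+$; * if $P_F$ is a convex $\ell$-gon with $\ell\in\{4,5\}$, $F$ has at most $4$ isolated roots in $\mathbb{R}^2_+$. The bounds $2$ and $4$ are attained: for $(x^2+y^2-25,\ x+y-7)$, $P_F$ is a triangle and there are exactly $2$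 isolated roots in $\mathbb{R}^2_+$; for $(x^2-3x+2,\ y^2-3y+2)$, $P_F$ is a quadrilateral and there are exactly $4$; for $(y^2-7y+12,\ -1+xy-x^2)$, $P_F$ is a pentagon and there are exactly $4$. -/

import Mathlib

open scoped Pointwise

noncomputable section

/-- The ring `ℝ[x^a | a ∈ ℝⁿ]` of `n`-variate real polynomials with real exponents: finite formal
real linear combinations of monomials `x^a`, with `x^a * x^b = x^(a+b)`. -/
abbrev Fewnomial (n : ℕ) : Type := AddMonoidAlgebra ℝ (Fin n → ℝ)

namespace Fewnomial

/-- The term `c x^a`. -/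
def term {n : ℕ} (c : ℝ) (a : Fin n → ℝ) : Fewnomial n := AddMonoidAlgebra.single a c

/-- The support: the finite set of exponent vectors with nonzero coefficient. -/
def supp {n : ℕ} (f : Fewnomial n) : Finset (Fin n → ℝ) := f.coeff.support

/-- The value `∑ c_a x₁^{a₁} ⋯ xₙ^{aₙ}` at a point (meant for the positive orthant). -/
def eval {n : ℕ} (f : Fewnomial n) (x : Fin n → ℝ) : ℝ :=
  ∑ a ∈ f.supp, f.coeff a * ∏ i, x i ^ a i

/-- The Newton polytope: the convex hull of the support. -/
def newt {n : ℕ} (f : Fewnomial n) : Set (Fin n → ℝ) := convexHull ℝ (f.supp : Set (Fin n → ℝ))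

end Fewnomial

/-- A `k × n` fewnomial system. -/
abbrev FewnomialSystem (k n : ℕ) : Type := Fin k → Fewnomial n

namespace FewnomialSystem

/-- The system is of type `(m₁, …, m_k)`: the `i`-th polynomial has exactly `m i` monomial terms
(used with all `m i ≥ 1`). -/
def IsOfType {k n : ℕ} (F : FewnomialSystem k n) (m : Fin k → ℕ) : Prop :=
  ∀ i, (F i).supp.card = m i

/-- The zero set `Z₊(F)` in the open positive orthant. -/
def posZeros {k n : ℕ} (F : FewnomialSystem k n) : Set (Fin n → ℝ) :=
  {x | (∀ j, 0 < x j) ∧ ∀ i, (F i).eval x = 0}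

/-- The polygon `P_F = Newt(f₁) + Newt(f₂)` (Minkowski sum) of a `2 × 2` system. -/
def polygon (F : FewnomialSystem 2 2) : Set (Fin 2 → ℝ) := (F 0).newt + (F 1).newt

end FewnomialSystem

/-- An arc: a homeomorphic image of the unit circle or of a (closed, open or half-open) interval.
The one-point interval `[a, a]` is included. -/
def IsArc {X : Type*} [TopologicalSpace X] (S : Set X) : Prop :=
  Nonempty (Circle ≃ₜ S) ∨ ∃ I : Set ℝ, I.OrdConnected ∧ Nonempty (I ≃ₜ S)

namespace FewnomialSystem

/-- The isolated roots in the positive orthant: the roots `z` such that the only arc of roots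
containing `z` is `{z}`. -/
def isolatedPosZeros {k n : ℕ} (F : FewnomialSystem k n) : Set (Fin n → ℝ) :=
  {z | z ∈ F.posZeros ∧ ∀ S : Set (Fin n → ℝ), IsArc S → S ⊆ F.posZeros → z ∈ S → S = {z}}

end FewnomialSystem

/-- A (nondegenerate) line segment in the plane. -/
def IsLineSegment (P : Set (Fin 2 → ℝ)) : Prop :=
  ∃ p q : Fin 2 → ℝ, p ≠ q ∧ P = segment ℝ p q

/-- A convex `l`-gon in the plane (`l ≥ 3`): a set with exactly `l` vertices (extreme points), of
which it is the convex hull. -/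
def IsConvexPolygon (l : ℕ) (P : Set (Fin 2 → ℝ)) : Prop :=
  3 ≤ l ∧ (P.extremePoints ℝ).encard = l ∧ convexHull ℝ (P.extremePoints ℝ) = P

end

/-! The bounds combine a Rolle count in one variable with the combinatorics of vertices of a
Minkowski sum.

If the exponents `p` of one trinomial form a triangle, the monomials with exponents `p 1 - p 0` and
`p 2 - p 0` are coordinates on the positive quadrant. In them that trinomial says that the second
coordinate is `α + β t`, with `t` the first, so its zero set is parametrized by an interval. On this
interval the other trinomial becomes a constant plus two terms `t ^ a * (α + β * t) ^ b`. If this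
function vanishes identically, the common zero set is itself an open arc and nothing is isolated;
otherwise its zeros bound the number of roots (`encard_arcIsolated_le`). Repeated differentiation,
dividing out power factors, gives 2 zeros for homothetic triangles, and 4 when the triangles share
an edge direction or the other polygon is a segment. Two non-parallel segments decouple into two
univariate trinomials with at most 2 · 2 common roots; parallel segments put every root on a curve
of roots.

Each pair of indices exposed by a common linear functional gives a different vertex of the Minkowski
sum (`encard_exposedPairs_le`), so few vertices force a favourable case. Fewer than four exposed
pairs leave only parallel segments and homothetic triangles. Fewer than six leave a segment or two
triangles with a common outer normal, hence with parallel edges. -/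

noncomputable section

/-! ### Zero counts by Rolle's theorem -/

/-- On `I`, the function `f` vanishes identically or has at most `n` zeros. -/
def ZerosLE (I : Set ℝ) (f : ℝ → ℝ) (n : ℕ) : Prop :=
  (∀ t ∈ I, f t = 0) ∨ {t ∈ I | f t = 0}.encard ≤ n

/-- Among `n + 2` zeros in increasing order there are `n + 1` disjoint gaps, and Rolle puts a zero
of the derivative in each; order-connectedness keeps the gaps inside `I`. -/
theorem encard_zeros_le_of_deriv {I : Set ℝ} (hI : I.OrdConnected) {f f' : ℝ → ℝ}
    (hf : ∀ t ∈ I, HasDerivAt f (f' t) t) {n : ℕ} (h : {t ∈ I | f' t = 0}.encard ≤ n) :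
    {t ∈ I | f t = 0}.encard ≤ (n + 1 : ℕ) := by
  by_contra hc
  have h2 : ((n + 2 : ℕ) : ℕ∞) ≤ {t ∈ I | f t = 0}.encard := by
    rw [not_le] at hc
    have := Order.add_one_le_of_lt hc
    exact_mod_cast this
  obtain ⟨T, hT, hTc⟩ := Set.exists_subset_encard_eq h2
  have hfin : T.Finite := Set.finite_of_encard_eq_coe hTc
  have hcard : hfin.toFinset.card = n + 2 := by
    rw [hfin.encard_eq_coe_toFinset_card] at hTc
    exact_mod_cast hTc
  let e := hfin.toFinset.orderEmbOfFin hcard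
  have he : ∀ i, e i ∈ I ∧ f (e i) = 0 := fun i =>
    hT (hfin.mem_toFinset.1 (hfin.toFinset.orderEmbOfFin_mem hcard i))
  have key : ∀ i : Fin (n + 1), ∃ c ∈ Set.Ioo (e i.castSucc) (e i.succ), f' c = 0 := by
    intro i
    have hsub : Set.Icc (e i.castSucc) (e i.succ) ⊆ I := hI.out (he _).1 (he _).1
    refine exists_hasDerivAt_eq_zero (f := f) (e.strictMono i.castSucc_lt_succ) ?_ ?_ ?_
    · exact fun x hx => (hf x (hsub hx)).continuousAt.continuousWithinAt
    · rw [(he _).2, (he _).2]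
    · exact fun x hx => hf x (hsub (Set.Ioo_subset_Icc_self hx))
  choose c hc1 hc2 using key
  have hmono : StrictMono c := by
    intro i j hij
    calc c i < e i.succ := (hc1 i).2
      _ ≤ e j.castSucc := e.monotone (by
          rw [Fin.le_def]; simp only [Fin.val_succ, Fin.val_castSucc]; exact hij)
      _ < c j := (hc1 j).1
  have hr : Set.range c ⊆ {t ∈ I | f' t = 0} := by
    rintro _ ⟨i, rfl⟩
    exact ⟨hI.out (he i.castSucc).1 (he i.succ).1 (Set.Ioo_subset_Icc_self (hc1 i)), hc2 i⟩
  have h3 := (Set.encard_le_encard hr).trans h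
  rw [← Set.image_univ, hmono.injective.encard_image, Set.encard_univ] at h3
  simp only [ENat.card_eq_coe_fintype_card, Fintype.card_fin] at h3
  have : n + 1 ≤ n := by exact_mod_cast h3
  omega

/-- A derivative that vanishes identically makes `f` constant, hence identically zero or without
zeros. The first alternative of `ZerosLE` therefore survives integration, and degenerate
coefficients need no separate treatment. -/
theorem ZerosLE.of_deriv {I : Set ℝ} (hI : I.OrdConnected) {f f' : ℝ → ℝ}
    (hf : ∀ t ∈ I, HasDerivAt f (f' t) t) {n : ℕ} (h : ZerosLE I f' n) :
    ZerosLE I f (n + 1) := by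
  rcases h with h | h
  · by_cases hz : ∃ a ∈ I, f a = 0
    · obtain ⟨a, ha, ha0⟩ := hz
      left
      intro b hb
      rw [← ha0]
      have hd : ∀ x ∈ I, HasDerivWithinAt f (f' x) I x := fun x hx => (hf x hx).hasDerivWithinAt
      have := hI.convex.norm_image_sub_le_of_norm_hasDerivWithin_le (C := 0) hd
        (fun x hx => by rw [h x hx, norm_zero]) ha hb
      rw [zero_mul] at this
      exact sub_eq_zero.1 (norm_le_zero_iff.1 this)
    · right
      have : {t ∈ I | f t = 0} = ∅ := by
        ext t
        simp only [Set.mem_ofPred_eq, Set.mem_empty_iff_false, iff_false]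
        exact fun ht => hz ⟨t, ht⟩
      rw [this, Set.encard_empty]
      exact zero_le
  · exact Or.inr (encard_zeros_le_of_deriv hI hf h)

theorem ZerosLE.of_mul {I : Set ℝ} {f g k : ℝ → ℝ} (hk : ∀ t ∈ I, k t ≠ 0)
    (hfg : ∀ t ∈ I, f t = k t * g t) {n : ℕ} (h : ZerosLE I g n) : ZerosLE I f n := by
  rcases h with h | h
  · left
    intro t ht
    rw [hfg t ht, h t ht, mul_zero]
  · right
    refine le_trans (Set.encard_le_encard ?_) h
    rintro t ⟨ht, h0⟩
    rw [hfg t ht] at h0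
    exact ⟨ht, (mul_eq_zero.1 h0).resolve_left (hk t ht)⟩

theorem zerosLE_const (I : Set ℝ) (a : ℝ) : ZerosLE I (fun _ => a) 0 := by
  by_cases ha : a = 0
  · exact Or.inl fun _ _ => ha
  · right
    simp [ha]

theorem zerosLE_linear {I : Set ℝ} (hI : I.OrdConnected) (a b : ℝ) :
    ZerosLE I (fun t => a + b * t) 1 := by
  refine ZerosLE.of_deriv hI (f' := fun _ => b) (fun t _ => ?_) (zerosLE_const I b)
  simpa using ((hasDerivAt_id t).const_mul b).const_add a

theorem zerosLE_quadratic {I : Set ℝ} (hI : I.OrdConnected) (a b c : ℝ) :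
    ZerosLE I (fun t => a + b * t + c * t ^ 2) 2 := by
  refine ZerosLE.of_deriv hI (f' := fun t => b + 2 * c * t) (fun t _ => ?_)
    (zerosLE_linear hI b _)
  have := (((hasDerivAt_id t).const_mul b).const_add a).add
    (((hasDerivAt_id t).pow 2).const_mul c)
  refine this.congr_deriv ?_
  simp
  ring

/-- The points of the positive half-line at which `α + β t` is positive. -/
def posDomain (α β : ℝ) : Set ℝ := {t | 0 < t ∧ 0 < α + β * t}

theorem ordConnected_posDomain (α β : ℝ) : (posDomain α β).OrdConnected := by
  refine ⟨fun x hx y hy z hz => ⟨hx.1.trans_le hz.1, ?_⟩⟩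
  rcases le_total 0 β with h | h
  · nlinarith [hx.2, mul_le_mul_of_nonneg_left hz.1 h]
  · nlinarith [hy.2, mul_le_mul_of_nonpos_left hz.2 h]

theorem isOpen_posDomain (α β : ℝ) : IsOpen (posDomain α β) :=
  (isOpen_lt continuous_const continuous_id).inter
    (isOpen_lt continuous_const (continuous_const.add (continuous_const.mul continuous_id)))

theorem hasDerivAt_rpow_mul_rpow {α β t : ℝ} (ht : t ∈ posDomain α β) (c d : ℝ) :
    HasDerivAt (fun t => t ^ c * (α + β * t) ^ d)
      (t ^ (c - 1) * (α + β * t) ^ (d - 1) * (c * (α + β * t) + d * β * t)) t := by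
  have h1 : HasDerivAt (fun t => t ^ c) (c * t ^ (c - 1)) t :=
    Real.hasDerivAt_rpow_const (Or.inl ht.1.ne')
  have h2 : HasDerivAt (fun t => α + β * t) β t := by
    simpa using ((hasDerivAt_id t).const_mul β).const_add α
  have h3 := h2.rpow_const (p := d) (Or.inl ht.2.ne')
  refine (h1.mul h3).congr_deriv ?_
  have e1 : t ^ c = t ^ (c - 1) * t := by
    rw [Real.rpow_sub_one ht.1.ne', div_mul_cancel₀ _ ht.1.ne']
  have e2 : (α + β * t) ^ d = (α + β * t) ^ (d - 1) * (α + β * t) := by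
    rw [Real.rpow_sub_one ht.2.ne', div_mul_cancel₀ _ ht.2.ne']
  rw [e1, e2]
  ring

theorem rpow_mul_rpow_ne_zero {α β t : ℝ} (ht : t ∈ posDomain α β) (c d : ℝ) :
    t ^ c * (α + β * t) ^ d ≠ 0 :=
  (mul_pos (Real.rpow_pos_of_pos ht.1 _) (Real.rpow_pos_of_pos ht.2 _)).ne'

/-- Rolle is used twice. Dividing the derivative by `t ^ (a - 1)` turns the `d₁` term into a
constant, which the second differentiation removes; what remains is a product of powers times a
quadratic, so the count is 2 + 1 + 1. -/
theorem zerosLE_four_of_edge (α β d₀ d₁ d₂ a c d : ℝ) :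
    ZerosLE (posDomain α β) (fun t => d₀ + d₁ * t ^ a + d₂ * (t ^ c * (α + β * t) ^ d)) 4 := by
  have hI := ordConnected_posDomain α β
  have hQ : ZerosLE (posDomain α β) (fun t => d₂ * (t ^ (c - a - 1) * (α + β * t) ^ (d - 1 - 1) *
      (((c - a) * (α + β * t) + (d - 1) * β * t) * (c * (α + β * t) + d * β * t) +
        (c + d) * β * (t * (α + β * t))))) 2 := by
    by_cases hd : d₂ = 0
    · left
      intro t _
      simp [hd]
    refine ZerosLE.of_mul (k := fun t => d₂ * (t ^ (c - a - 1) * (α + β * t) ^ (d - 1 - 1)))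
      (fun t ht => mul_ne_zero hd (rpow_mul_rpow_ne_zero ht _ _)) (fun t ht => ?_)
      (zerosLE_quadratic hI ((c - a) * c * α ^ 2)
        ((c - a) * α * (c + d) * β + (c - a + d - 1) * β * c * α + (c + d) * β * α)
        ((c - a + d - 1) * β * (c + d) * β + (c + d) * β ^ 2))
    ring
  have hh : ZerosLE (posDomain α β) (fun t => d₁ * a + d₂ * (t ^ (c - a) * (α + β * t) ^ (d - 1) *
      (c * (α + β * t) + d * β * t))) 3 := by
    refine ZerosLE.of_deriv hI (fun t ht => ?_) hQ
    have h1 := hasDerivAt_rpow_mul_rpow ht (c - a) (d - 1)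
    have h2 : HasDerivAt (fun t => c * (α + β * t) + d * β * t) ((c + d) * β) t := by
      have := ((((hasDerivAt_id t).const_mul β).const_add α).const_mul c).add
        ((hasDerivAt_id t).const_mul (d * β))
      refine this.congr_deriv ?_
      ring
    refine (((h1.mul h2).const_mul d₂).const_add (d₁ * a)).congr_deriv ?_
    have e1 : t ^ (c - a) = t ^ (c - a - 1) * t := by
      rw [Real.rpow_sub_one ht.1.ne' (c - a), div_mul_cancel₀ _ ht.1.ne']
    have e2 : (α + β * t) ^ (d - 1) = (α + β * t) ^ (d - 1 - 1) * (α + β * t) := by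
      rw [Real.rpow_sub_one ht.2.ne' (d - 1), div_mul_cancel₀ _ ht.2.ne']
    rw [e1, e2]
    ring
  have hg := ZerosLE.of_mul (k := fun t => t ^ (a - 1))
    (f := fun t => d₁ * (a * t ^ (a - 1)) + d₂ * (t ^ (c - 1) * (α + β * t) ^ (d - 1) *
      (c * (α + β * t) + d * β * t)))
    (fun t ht => (Real.rpow_pos_of_pos ht.1 _).ne') (fun t ht => ?_) hh
  · refine ZerosLE.of_deriv hI (fun t ht => ?_) hg
    exact (((Real.hasDerivAt_rpow_const (Or.inl ht.1.ne')).const_mul d₁).const_add d₀).add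
      ((hasDerivAt_rpow_mul_rpow ht c d).const_mul d₂)
  · have e1 : t ^ (c - 1) = t ^ (a - 1) * t ^ (c - a) := by
      rw [← Real.rpow_add ht.1]
      congr 1
      ring
    rw [e1]
    ring

/-- After dividing the derivative by `l * t ^ (l - 1)`, the exponents of `t` and `α + β * t` in the
last term add up to zero. In its derivative the linear factor then collapses to the constant `(1 -
l) * α`, so the count is 0 + 1 + 1. -/
theorem zerosLE_two_of_homothetic (α β d₀ d₁ d₂ l : ℝ) :
    ZerosLE (posDomain α β) (fun t => d₀ + d₁ * t ^ l + d₂ * (α + β * t) ^ l) 2 := by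
  have hI := ordConnected_posDomain α β
  have hQ : ZerosLE (posDomain α β) (fun t => d₂ * β * (t ^ (1 - l - 1) *
      (α + β * t) ^ (l - 1 - 1) * ((1 - l) * (α + β * t) + (l - 1) * β * t))) 0 := by
    refine ZerosLE.of_mul (k := fun t => t ^ (1 - l - 1) * (α + β * t) ^ (l - 1 - 1))
      (fun t ht => rpow_mul_rpow_ne_zero ht _ _) (fun t ht => ?_)
      (zerosLE_const _ (d₂ * β * ((1 - l) * α)))
    ring
  have hh : ZerosLE (posDomain α β) (fun t => d₁ + d₂ * β * (t ^ (1 - l) *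
      (α + β * t) ^ (l - 1))) 1 :=
    ZerosLE.of_deriv hI (fun t ht =>
      ((hasDerivAt_rpow_mul_rpow ht (1 - l) (l - 1)).const_mul (d₂ * β)).const_add d₁) hQ
  -- The factor `l` cannot be divided out here, but the function is constant.
  by_cases hl : l = 0
  · subst hl
    simp only [Real.rpow_zero]
    rcases zerosLE_const (posDomain α β) (d₀ + d₁ * 1 + d₂ * 1) with h | h
    · exact Or.inl h
    · exact Or.inr (h.trans (by norm_num))
  have hg := ZerosLE.of_mul (k := fun t => l * t ^ (l - 1))
    (f := fun t => d₁ * (l * t ^ (l - 1)) + d₂ * (β * l * (α + β * t) ^ (l - 1)))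
    (fun t ht => mul_ne_zero hl (Real.rpow_pos_of_pos ht.1 _).ne') (fun t ht => ?_) hh
  · refine ZerosLE.of_deriv hI (fun t ht => ?_) hg
    have h2 : HasDerivAt (fun t => α + β * t) β t := by
      simpa using ((hasDerivAt_id t).const_mul β).const_add α
    exact (((Real.hasDerivAt_rpow_const (Or.inl ht.1.ne')).const_mul d₁).const_add d₀).add
      ((h2.rpow_const (p := l) (Or.inl ht.2.ne')).const_mul d₂)
  · have e1 : t ^ (l - 1) * t ^ (1 - l) = 1 := by
      rw [← Real.rpow_add ht.1]
      simp
    linear_combination -(d₂ * β * l * (α + β * t) ^ (l - 1)) * e1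

/-- A univariate trinomial has at most two positive roots. -/
theorem encard_pos_zeros_trinomial_le {d₀ d₁ d₂ s : ℝ} (hd : d₂ ≠ 0) (h0 : s ≠ 0) (h1 : s ≠ 1) :
    {m ∈ Set.Ioi (0 : ℝ) | d₀ + d₁ * m + d₂ * m ^ s = 0}.encard ≤ 2 := by
  refine encard_zeros_le_of_deriv (n := 1) Set.ordConnected_Ioi
    (f' := fun m => d₁ + d₂ * (s * m ^ (s - 1))) (fun m hm => ?_) ?_
  · have := (((hasDerivAt_id m).const_mul d₁).const_add d₀).add
      ((Real.hasDerivAt_rpow_const (p := s) (Or.inl (ne_of_gt hm))).const_mul d₂)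
    refine this.congr_deriv ?_
    simp
  refine encard_zeros_le_of_deriv (n := 0) Set.ordConnected_Ioi
    (f' := fun m => d₂ * (s * ((s - 1) * m ^ (s - 1 - 1)))) (fun m hm => ?_) ?_
  · exact (((Real.hasDerivAt_rpow_const (Or.inl (ne_of_gt hm))).const_mul s).const_mul
      d₂).const_add d₁
  · rw [Nat.cast_zero, nonpos_iff_eq_zero, Set.encard_eq_zero]
    ext m
    simp only [Set.mem_ofPred_eq, Set.mem_empty_iff_false, iff_false]
    rintro ⟨hm, h⟩
    -- The exponents 0, 1, `s` are distinct, so the second derivative never vanishes.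
    exact mul_ne_zero hd (mul_ne_zero h0 (mul_ne_zero (sub_ne_zero.2 h1)
      (Real.rpow_pos_of_pos hm _).ne')) h

theorem zerosLE_two_monomial_sub (α β a b m : ℝ) :
    ZerosLE (posDomain α β) (fun t => t ^ a * (α + β * t) ^ b - m) 2 := by
  have hI := ordConnected_posDomain α β
  have h1 := ZerosLE.of_mul (I := posDomain α β)
    (k := fun t => t ^ (a - 1) * (α + β * t) ^ (b - 1))
    (f := fun t => t ^ (a - 1) * (α + β * t) ^ (b - 1) * (a * (α + β * t) + b * β * t))
    (fun t ht => rpow_mul_rpow_ne_zero ht _ _) (fun t ht => by ring)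
    (zerosLE_linear hI (a * α) ((a + b) * β))
  exact ZerosLE.of_deriv hI (fun t ht => (hasDerivAt_rpow_mul_rpow ht a b).sub_const m) h1

/-- The function is a univariate trinomial evaluated at the single quantity `t ^ a * (α + β * t) ^
b`: at most two admissible values, each taken at most twice. -/
theorem zerosLE_four_of_segment (α β d₀ d₁ a b : ℝ) {d₂ s : ℝ} (hd : d₂ ≠ 0) (h0 : s ≠ 0)
    (h1 : s ≠ 1) :
    ZerosLE (posDomain α β) (fun t => d₀ + d₁ * (t ^ a * (α + β * t) ^ b) +
      d₂ * (t ^ a * (α + β * t) ^ b) ^ s) 4 := by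
  have hR := encard_pos_zeros_trinomial_le (d₀ := d₀) (d₁ := d₁) hd h0 h1
  set R := {m ∈ Set.Ioi (0 : ℝ) | d₀ + d₁ * m + d₂ * m ^ s = 0}
  have hpos : ∀ t ∈ posDomain α β, 0 < t ^ a * (α + β * t) ^ b := fun t ht =>
    mul_pos (Real.rpow_pos_of_pos ht.1 _) (Real.rpow_pos_of_pos ht.2 _)
  -- If the inner quantity is constant and equal to a root, the whole function is zero; otherwise no
  -- fibre over a root is the whole domain, so each has at most two points.
  by_cases hall : ∃ m ∈ R, ∀ t ∈ posDomain α β, t ^ a * (α + β * t) ^ b - m = 0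
  · obtain ⟨m, hm, hm'⟩ := hall
    left
    intro t ht
    have := sub_eq_zero.1 (hm' t ht)
    simp only [this]
    exact hm.2
  · right
    push Not at hall
    have hfib : ∀ m ∈ R, {t ∈ posDomain α β | t ^ a * (α + β * t) ^ b - m = 0}.encard ≤ 2 := by
      intro m hm
      rcases zerosLE_two_monomial_sub α β a b m with h | h
      · obtain ⟨t, ht, hne⟩ := hall m hm
        exact absurd (h t ht) hne
      · exact h
    have hRf : R.Finite := Set.finite_of_encard_le_coe (k := 2) hR
    have hsub : {t ∈ posDomain α β | d₀ + d₁ * (t ^ a * (α + β * t) ^ b) +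
        d₂ * (t ^ a * (α + β * t) ^ b) ^ s = 0} ⊆
        ⋃ m ∈ hRf.toFinset, {t ∈ posDomain α β | t ^ a * (α + β * t) ^ b - m = 0} := by
      rintro t ⟨ht, h⟩
      simp only [Set.mem_iUnion]
      exact ⟨t ^ a * (α + β * t) ^ b, hRf.mem_toFinset.2 ⟨hpos t ht, h⟩, ht, sub_self _⟩
    refine (Set.encard_le_encard hsub).trans ?_
    have hb : ∀ T : Finset ℝ, (∀ m ∈ T, m ∈ R) →
        (⋃ m ∈ T, {t ∈ posDomain α β | t ^ a * (α + β * t) ^ b - m = 0}).encard ≤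
          (T.card : ℕ∞) * 2 := by
      classical
      intro T
      induction T using Finset.induction_on with
      | empty => simp
      | insert m T hm ih =>
        intro hT
        rw [Finset.set_biUnion_insert, Finset.card_insert_of_notMem hm]
        refine (Set.encard_union_le _ _).trans ?_
        push_cast
        rw [add_mul, one_mul, add_comm]
        exact add_le_add (ih fun x hx => hT x (Finset.mem_insert_of_mem hx))
          (hfib m (hT m (Finset.mem_insert_self _ _)))
    refine (hb _ fun m hm => hRf.mem_toFinset.1 hm).trans ?_
    rw [← hRf.encard_eq_coe_toFinset_card]
    calc R.encard * 2 ≤ 2 * 2 := by gcongr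
      _ = ((4 : ℕ) : ℕ∞) := by norm_num

/-! ### Monomials as coordinates on the positive quadrant -/

/-- The planar cross product. -/
def cross (u v : Fin 2 → ℝ) : ℝ := u 0 * v 1 - u 1 * v 0

/-- The monomial `x^a`. -/
def mon (a x : Fin 2 → ℝ) : ℝ := ∏ i, x i ^ a i

theorem mon_eq (a x : Fin 2 → ℝ) : mon a x = x 0 ^ a 0 * x 1 ^ a 1 := by
  simp [mon, Fin.prod_univ_two]

theorem mon_pos {x : Fin 2 → ℝ} (hx : ∀ j, 0 < x j) (a : Fin 2 → ℝ) : 0 < mon a x :=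
  Finset.prod_pos fun j _ => Real.rpow_pos_of_pos (hx j) _

theorem mon_add {x : Fin 2 → ℝ} (hx : ∀ j, 0 < x j) (a b : Fin 2 → ℝ) :
    mon (a + b) x = mon a x * mon b x := by
  simp only [mon_eq, Pi.add_apply, Real.rpow_add (hx _)]
  ring

theorem mon_smul {x : Fin 2 → ℝ} (hx : ∀ j, 0 < x j) (s : ℝ) (a : Fin 2 → ℝ) :
    mon (s • a) x = mon a x ^ s := by
  simp only [mon_eq, Pi.smul_apply, smul_eq_mul]
  rw [Real.mul_rpow (Real.rpow_pos_of_pos (hx _) _).le (Real.rpow_pos_of_pos (hx _) _).le,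
    ← Real.rpow_mul (hx _).le, ← Real.rpow_mul (hx _).le, mul_comm s, mul_comm s]

/-- The trinomial with coefficients `c` and exponents `p`. -/
def tri (c : Fin 3 → ℝ) (p : Fin 3 → Fin 2 → ℝ) (x : Fin 2 → ℝ) : ℝ := ∑ i, c i * mon (p i) x

theorem tri_perm (c : Fin 3 → ℝ) (p : Fin 3 → Fin 2 → ℝ) (σ : Equiv.Perm (Fin 3))
    (x : Fin 2 → ℝ) : tri (c ∘ σ) (p ∘ σ) x = tri c p x :=
  Equiv.sum_comp σ fun i => c i * mon (p i) x

theorem tri_factor {x : Fin 2 → ℝ} (hx : ∀ j, 0 < x j) (c : Fin 3 → ℝ) (p : Fin 3 → Fin 2 → ℝ) :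
    tri c p x = mon (p 0) x * (c 0 + c 1 * mon (p 1 - p 0) x + c 2 * mon (p 2 - p 0) x) := by
  have h1 : mon (p 1) x = mon (p 0) x * mon (p 1 - p 0) x := by
    rw [← mon_add hx, add_sub_cancel]
  have h2 : mon (p 2) x = mon (p 0) x * mon (p 2 - p 0) x := by
    rw [← mon_add hx, add_sub_cancel]
  rw [tri, Fin.sum_univ_three, h1, h2]
  ring

theorem tri_eq_zero_iff {x : Fin 2 → ℝ} (hx : ∀ j, 0 < x j) (c : Fin 3 → ℝ)
    (p : Fin 3 → Fin 2 → ℝ) :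
    tri c p x = 0 ↔ c 0 + c 1 * mon (p 1 - p 0) x + c 2 * mon (p 2 - p 0) x = 0 := by
  rw [tri_factor hx, mul_eq_zero]
  exact or_iff_right (mon_pos hx _).ne'

/-- The positive common zeros of two functions. -/
def posCommonZeros (f g : (Fin 2 → ℝ) → ℝ) : Set (Fin 2 → ℝ) :=
  {x | (∀ j, 0 < x j) ∧ f x = 0 ∧ g x = 0}

theorem posCommonZeros_comm (f g : (Fin 2 → ℝ) → ℝ) :
    posCommonZeros f g = posCommonZeros g f := by
  ext x
  exact and_congr_right fun _ => and_comm

/-- The points of `Z` that lie on no arc inside `Z` but the one-point arc. -/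
def arcIsolated (Z : Set (Fin 2 → ℝ)) : Set (Fin 2 → ℝ) :=
  {z | z ∈ Z ∧ ∀ S : Set (Fin 2 → ℝ), IsArc S → S ⊆ Z → z ∈ S → S = {z}}

/-- The positive point at which the monomials `x^u` and `x^v` take the values `t` and `l`. -/
def monSolve (u v : Fin 2 → ℝ) (t l : ℝ) : Fin 2 → ℝ :=
  ![t ^ (v 1 / cross u v) * l ^ (-u 1 / cross u v), t ^ (-v 0 / cross u v) * l ^ (u 0 / cross u v)]

theorem monSolve_pos (u v : Fin 2 → ℝ) {t l : ℝ} (ht : 0 < t) (hl : 0 < l) (j : Fin 2) :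
    0 < monSolve u v t l j := by
  fin_cases j <;>
    exact mul_pos (Real.rpow_pos_of_pos ht _) (Real.rpow_pos_of_pos hl _)

/-- The exponents are the coordinates of `a` in the basis `u`, `v` by Cramer's rule. -/
theorem mon_monSolve (u v a : Fin 2 → ℝ) {t l : ℝ} (ht : 0 < t) (hl : 0 < l) :
    mon a (monSolve u v t l) = t ^ (cross a v / cross u v) * l ^ (cross u a / cross u v) := by
  have h1 := fun r => (Real.rpow_pos_of_pos ht r).le
  have h2 := fun r => (Real.rpow_pos_of_pos hl r).le
  rw [mon_eq]
  simp only [monSolve, Matrix.cons_val_zero, Matrix.cons_val_one]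
  rw [Real.mul_rpow (h1 _) (h2 _), Real.mul_rpow (h1 _) (h2 _), ← Real.rpow_mul ht.le,
    ← Real.rpow_mul ht.le, ← Real.rpow_mul hl.le, ← Real.rpow_mul hl.le, mul_mul_mul_comm,
    ← Real.rpow_add ht, ← Real.rpow_add hl]
  congr 2 <;> rw [cross, cross] <;> ring

theorem mon_left_monSolve {u v : Fin 2 → ℝ} (h : cross u v ≠ 0) {t l : ℝ} (ht : 0 < t)
    (hl : 0 < l) : mon u (monSolve u v t l) = t := by
  have : cross u u = 0 := by rw [cross]; ring
  rw [mon_monSolve u v u ht hl, div_self h, this, zero_div, Real.rpow_one, Real.rpow_zero, mul_one]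

theorem mon_right_monSolve {u v : Fin 2 → ℝ} (h : cross u v ≠ 0) {t l : ℝ} (ht : 0 < t)
    (hl : 0 < l) : mon v (monSolve u v t l) = l := by
  have : cross v v = 0 := by rw [cross]; ring
  rw [mon_monSolve u v v ht hl, div_self h, this, zero_div, Real.rpow_one, Real.rpow_zero, one_mul]

theorem monSolve_mon {u v : Fin 2 → ℝ} (h : cross u v ≠ 0) {x : Fin 2 → ℝ} (hx : ∀ j, 0 < x j) :
    monSolve u v (mon u x) (mon v x) = x := by
  have key : ∀ r s : ℝ, mon u x ^ (r / cross u v) * mon v x ^ (s / cross u v) =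
      x 0 ^ ((r * u 0 + s * v 0) / cross u v) * x 1 ^ ((r * u 1 + s * v 1) / cross u v) := by
    intro r s
    rw [← mon_smul hx, ← mon_smul hx, ← mon_add hx, mon_eq]
    congr 2 <;> simp <;> ring
  have e1 : v 1 * u 0 + -u 1 * v 0 = cross u v := by rw [cross]; ring
  have e2 : v 1 * u 1 + -u 1 * v 1 = 0 := by ring
  have e3 : -v 0 * u 0 + u 0 * v 0 = 0 := by ring
  have e4 : -v 0 * u 1 + u 0 * v 1 = cross u v := by rw [cross]; ring
  ext j
  fin_cases j
  · change mon u x ^ _ * mon v x ^ _ = x 0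
    rw [key, e1, e2, div_self h, zero_div, Real.rpow_one, Real.rpow_zero, mul_one]
  · change mon u x ^ _ * mon v x ^ _ = x 1
    rw [key, e3, e4, div_self h, zero_div, Real.rpow_one, Real.rpow_zero, one_mul]

theorem continuousOn_mon (a : Fin 2 → ℝ) : ContinuousOn (mon a) {x | ∀ j, 0 < x j} := by
  have : mon a = fun x => x 0 ^ a 0 * x 1 ^ a 1 := funext (mon_eq a)
  rw [this]
  exact ((continuous_apply 0).continuousOn.rpow_const fun x hx => Or.inl (hx 0).ne').mul
    ((continuous_apply 1).continuousOn.rpow_const fun x hx => Or.inl (hx 1).ne')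

/-! ### Reduction of the systems to one variable -/

/-- Reduction of a pair of trinomials, the first with a triangle as its Newton polygon, to one
univariate function. -/
theorem encard_arcIsolated_le {c d : Fin 3 → ℝ} {p q : Fin 3 → Fin 2 → ℝ} (hc : c 2 ≠ 0)
    (hp : cross (p 1 - p 0) (p 2 - p 0) ≠ 0) {a₁ b₁ a₂ b₂ : ℝ}
    (h₁ : q 1 - q 0 = a₁ • (p 1 - p 0) + b₁ • (p 2 - p 0))
    (h₂ : q 2 - q 0 = a₂ • (p 1 - p 0) + b₂ • (p 2 - p 0)) {n : ℕ}
    (hz : ZerosLE (posDomain (-c 0 / c 2) (-c 1 / c 2)) (fun t => d 0 +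
      d 1 * (t ^ a₁ * (-c 0 / c 2 + -c 1 / c 2 * t) ^ b₁) +
      d 2 * (t ^ a₂ * (-c 0 / c 2 + -c 1 / c 2 * t) ^ b₂)) n) :
    (arcIsolated (posCommonZeros (tri c p) (tri d q))).encard ≤ n := by
  set u := p 1 - p 0 with hu
  set v := p 2 - p 0 with hv
  set α := -c 0 / c 2 with hα
  set β := -c 1 / c 2 with hβ
  set Z := posCommonZeros (tri c p) (tri d q) with hZ
  -- In the coordinates `mon u`, `mon v` the first curve is a graph over `posDomain α β`.
  have hf : ∀ x : Fin 2 → ℝ, (∀ j, 0 < x j) → (tri c p x = 0 ↔ mon v x = α + β * mon u x) := by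
    intro x hx
    rw [tri_eq_zero_iff hx, ← hu, ← hv, hα, hβ]
    field_simp
    constructor <;> intro h <;> linarith
  have hmon : ∀ (x : Fin 2 → ℝ), (∀ j, 0 < x j) → ∀ a b : ℝ,
      mon (a • u + b • v) x = mon u x ^ a * mon v x ^ b := by
    intro x hx a b
    rw [mon_add hx, mon_smul hx, mon_smul hx]
  have hg : ∀ x : Fin 2 → ℝ, (∀ j, 0 < x j) → (tri d q x = 0 ↔ d 0 +
      d 1 * (mon u x ^ a₁ * mon v x ^ b₁) + d 2 * (mon u x ^ a₂ * mon v x ^ b₂) = 0) := by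
    intro x hx
    rw [tri_eq_zero_iff hx, h₁, h₂, hmon x hx, hmon x hx]
  have hmem : ∀ x ∈ Z, mon u x ∈ posDomain α β := by
    rintro x ⟨hx, hx1, -⟩
    exact ⟨mon_pos hx u, ((hf x hx).1 hx1) ▸ mon_pos hx v⟩
  have hinv : ∀ x ∈ Z, monSolve u v (mon u x) (α + β * mon u x) = x := by
    rintro x ⟨hx, hx1, -⟩
    rw [← (hf x hx).1 hx1, monSolve_mon hp hx]
  rcases hz with hz | hz
  -- The second equation holds on the whole first curve, so `Z` is homeomorphic to an interval and
  -- is itself an arc. As the interval is open, `Z` has a second point whenever it has one.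
  · have hsol : ∀ t ∈ posDomain α β, monSolve u v t (α + β * t) ∈ Z := by
      intro t ht
      have hx := monSolve_pos u v ht.1 ht.2
      refine ⟨hx, (hf _ hx).2 ?_, (hg _ hx).2 ?_⟩
      · rw [mon_left_monSolve hp ht.1 ht.2, mon_right_monSolve hp ht.1 ht.2]
      · rw [mon_left_monSolve hp ht.1 ht.2, mon_right_monSolve hp ht.1 ht.2]
        exact hz t ht
    have hcont : ContinuousOn (fun t => monSolve u v t (α + β * t)) (posDomain α β) := by
      have h1 : ∀ r : ℝ, ContinuousOn (fun t : ℝ => t ^ r) (posDomain α β) := fun r =>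
        continuousOn_id.rpow_const fun t ht => Or.inl ht.1.ne'
      have h2 : ∀ r : ℝ, ContinuousOn (fun t : ℝ => (α + β * t) ^ r) (posDomain α β) := fun r =>
        ContinuousOn.rpow_const (by fun_prop) fun t ht => Or.inl ht.2.ne'
      refine continuousOn_pi.2 fun j => ?_
      fin_cases j
      · exact (h1 _).mul (h2 _)
      · exact (h1 _).mul (h2 _)
    let e : posDomain α β ≃ₜ Z :=
      { toFun := fun t => ⟨monSolve u v t (α + β * t), hsol t t.2⟩
        invFun := fun x => ⟨mon u x, hmem x x.2⟩
        left_inv := fun t => Subtype.ext (mon_left_monSolve hp t.2.1 t.2.2)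
        right_inv := fun x => Subtype.ext (hinv x x.2)
        continuous_toFun := (continuousOn_iff_continuous_domRestrict.1 hcont).subtype_mk _
        continuous_invFun := (continuousOn_iff_continuous_domRestrict.1
          ((continuousOn_mon u).mono fun x hx => hx.1)).subtype_mk _ }
    have harc : IsArc Z := Or.inr ⟨_, ordConnected_posDomain α β, ⟨e⟩⟩
    have hempty : arcIsolated Z = ∅ := by
      rw [Set.eq_empty_iff_forall_notMem]
      rintro z ⟨hz1, hz2⟩
      have hsing := hz2 Z harc subset_rfl hz1
      have ht := hmem z hz1
      obtain ⟨ε, hε, hball⟩ := Metric.isOpen_iff.1 (isOpen_posDomain α β) _ ht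
      have ht' : mon u z + ε / 2 ∈ posDomain α β := by
        refine hball ?_
        rw [Metric.mem_ball, Real.dist_eq, add_sub_cancel_left, abs_of_pos (half_pos hε)]
        exact half_lt_self hε
      have h3 := hsol _ ht'
      rw [hsing] at h3
      have h4 := mon_left_monSolve hp ht'.1 ht'.2
      rw [Set.mem_singleton_iff.1 h3] at h4
      linarith
    rw [hempty, Set.encard_empty]
    exact zero_le
  · have hinj : Set.InjOn (mon u) Z := by
      intro x hx y hy hxy
      rw [← hinv x hx, ← hinv y hy, hxy]
    calc (arcIsolated Z).encard ≤ Z.encard := Set.encard_le_encard fun z hz => hz.1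
      _ = (mon u '' Z).encard := hinj.encard_image.symm
      _ ≤ _ := Set.encard_le_encard ?_
      _ ≤ n := hz
    rintro _ ⟨x, hx, rfl⟩
    refine ⟨hmem x hx, ?_⟩
    have := (hg x hx.1).1 hx.2.2
    rwa [(hf x hx.1).1 hx.2.1] at this

/-- Two trinomials with parallel segments as Newton polygons. -/
theorem arcIsolated_eq_empty {c d : Fin 3 → ℝ} {p q : Fin 3 → Fin 2 → ℝ} {u : Fin 2 → ℝ}
    (hu : u ≠ 0) (hp : ∀ i, cross u (p i) = cross u (p 0))
    (hq : ∀ i, cross u (q i) = cross u (q 0)) :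
    arcIsolated (posCommonZeros (tri c p) (tri d q)) = ∅ := by
  rw [Set.eq_empty_iff_forall_notMem]
  rintro z ⟨hz1, hz2⟩
  have hz := hz1.1
  -- This is the orbit of `z` under a one-parameter group of scalings. It multiplies the monomial
  -- `a` by `exp (s * cross u a)`, which is the same factor for all terms of each trinomial, so the
  -- orbit stays in the zero set.
  let γ : ℝ → Fin 2 → ℝ := fun s => ![z 0 * Real.exp (s * -u 1), z 1 * Real.exp (s * u 0)]
  have hγ0 : ∀ s, γ s 0 = z 0 * Real.exp (s * -u 1) := fun s => rfl
  have hγ1 : ∀ s, γ s 1 = z 1 * Real.exp (s * u 0) := fun s => rfl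
  have hpos : ∀ s j, 0 < γ s j := by
    intro s j
    fin_cases j <;> exact mul_pos (hz _) (Real.exp_pos _)
  have hmon : ∀ s a, mon a (γ s) = mon a z * Real.exp (s * cross u a) := by
    intro s a
    rw [mon_eq, mon_eq, hγ0, hγ1, Real.mul_rpow (hz _).le (Real.exp_pos _).le,
      Real.mul_rpow (hz _).le (Real.exp_pos _).le, ← Real.exp_mul, ← Real.exp_mul,
      mul_mul_mul_comm, ← Real.exp_add, cross]
    congr 2
    ring
  have htri : ∀ (c : Fin 3 → ℝ) (p : Fin 3 → Fin 2 → ℝ), (∀ i, cross u (p i) = cross u (p 0)) →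
      ∀ s, tri c p (γ s) = tri c p z * Real.exp (s * cross u (p 0)) := by
    intro c p hp s
    rw [tri, tri, Finset.sum_mul]
    refine Finset.sum_congr rfl fun i _ => ?_
    rw [hmon, hp, mul_assoc]
  have hN : u 0 ^ 2 + u 1 ^ 2 ≠ 0 := by
    intro h
    apply hu
    ext j
    fin_cases j
    · change u 0 = 0
      nlinarith [sq_nonneg (u 0), sq_nonneg (u 1)]
    · change u 1 = 0
      nlinarith [sq_nonneg (u 0), sq_nonneg (u 1)]
  -- A continuous left inverse of `γ`, read off from logarithms; it makes the orbit a homeomorphic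
  -- copy of the line.
  let δ : (Fin 2 → ℝ) → ℝ := fun x =>
    (u 0 * Real.log (x 1 / z 1) - u 1 * Real.log (x 0 / z 0)) / (u 0 ^ 2 + u 1 ^ 2)
  have hδ : ∀ s, δ (γ s) = s := by
    intro s
    simp only [δ, hγ0, hγ1, mul_div_cancel_left₀ _ (hz _).ne', Real.log_exp]
    field_simp
    ring
  have hcγ : Continuous γ := by
    refine continuous_pi fun j => ?_
    fin_cases j
    · exact continuous_const.mul (Real.continuous_exp.comp (continuous_id.mul continuous_const))
    · exact continuous_const.mul (Real.continuous_exp.comp (continuous_id.mul continuous_const))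
  have hsub : Set.range γ ⊆ {x | ∀ j, 0 < x j} := by
    rintro _ ⟨s, rfl⟩
    exact hpos s
  have hcδ : ContinuousOn δ (Set.range γ) := by
    have h1 : ∀ j, ContinuousOn (fun x : Fin 2 → ℝ => Real.log (x j / z j)) (Set.range γ) :=
      fun j => ContinuousOn.log (by fun_prop) fun x hx => (div_pos (hsub hx j) (hz j)).ne'
    exact ((continuousOn_const.mul (h1 1)).sub (continuousOn_const.mul (h1 0))).div_const _
  let e : ℝ ≃ₜ Set.range γ :=
    { toFun := fun s => ⟨γ s, s, rfl⟩
      invFun := fun x => δ x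
      left_inv := hδ
      right_inv := by
        rintro ⟨_, s, rfl⟩
        exact Subtype.ext (congrArg γ (hδ s))
      continuous_toFun := hcγ.subtype_mk _
      continuous_invFun := continuousOn_iff_continuous_domRestrict.1 hcδ }
  have h0 : γ 0 = z := by
    ext j
    fin_cases j <;> simp [γ]
  have harc : IsArc (Set.range γ) :=
    Or.inr ⟨Set.univ, Set.ordConnected_univ, ⟨(Homeomorph.Set.univ ℝ).trans e⟩⟩
  have hZ : Set.range γ ⊆ posCommonZeros (tri c p) (tri d q) := by
    rintro _ ⟨s, rfl⟩
    exact ⟨hpos s, by rw [htri c p hp, hz1.2.1, zero_mul], by rw [htri d q hq, hz1.2.2, zero_mul]⟩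
  have hs := hz2 _ harc hZ ⟨0, h0⟩
  have h1 : γ 1 = z := by
    have : γ 1 ∈ Set.range γ := ⟨1, rfl⟩
    rwa [hs] at this
  have := hδ 1
  rw [h1, ← h0, hδ] at this
  exact zero_ne_one this

/-- Two trinomials with non-parallel segments as Newton polygons. -/
theorem encard_arcIsolated_le_of_segments {c d : Fin 3 → ℝ} {p q : Fin 3 → Fin 2 → ℝ}
    (hc : c 2 ≠ 0) (hd : d 2 ≠ 0) {u v : Fin 2 → ℝ} (huv : cross u v ≠ 0) {r s : ℝ}
    (hp1 : p 1 - p 0 = u) (hp2 : p 2 - p 0 = r • u) (hr0 : r ≠ 0) (hr1 : r ≠ 1)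
    (hq1 : q 1 - q 0 = v) (hq2 : q 2 - q 0 = s • v) (hs0 : s ≠ 0) (hs1 : s ≠ 1) :
    (arcIsolated (posCommonZeros (tri c p) (tri d q))).encard ≤ 4 := by
  set Z := posCommonZeros (tri c p) (tri d q)
  have hR := encard_pos_zeros_trinomial_le (d₀ := c 0) (d₁ := c 1) hc hr0 hr1
  have hS := encard_pos_zeros_trinomial_le (d₀ := d 0) (d₁ := d 1) hd hs0 hs1
  -- In the coordinates `mon u`, `mon v` each equation involves one coordinate only, so the roots
  -- inject into a product of two univariate root sets.
  have hinj : Set.InjOn (fun x => (mon u x, mon v x)) Z := by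
    intro x hx y hy hxy
    obtain ⟨h1, h2⟩ : mon u x = mon u y ∧ mon v x = mon v y := Prod.ext_iff.1 hxy
    rw [← monSolve_mon huv hx.1, ← monSolve_mon huv hy.1, h1, h2]
  calc (arcIsolated Z).encard ≤ Z.encard := Set.encard_le_encard fun z hz => hz.1
    _ = ((fun x => (mon u x, mon v x)) '' Z).encard := hinj.encard_image.symm
    _ ≤ ({m ∈ Set.Ioi (0 : ℝ) | c 0 + c 1 * m + c 2 * m ^ r = 0} ×ˢ
        {m ∈ Set.Ioi (0 : ℝ) | d 0 + d 1 * m + d 2 * m ^ s = 0}).encard :=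
      Set.encard_le_encard ?_
    _ ≤ 2 * 2 := by
      rw [Set.encard_prod]
      gcongr
    _ = 4 := by norm_num
  rintro _ ⟨x, hx, rfl⟩
  refine ⟨⟨mon_pos hx.1 _, ?_⟩, ⟨mon_pos hx.1 _, ?_⟩⟩
  · have := (tri_eq_zero_iff hx.1 _ _).1 hx.2.1
    rwa [hp1, hp2, mon_smul hx.1] at this
  · have := (tri_eq_zero_iff hx.1 _ _).1 hx.2.2
    rwa [hq1, hq2, mon_smul hx.1] at this

/-! ### Cross product identities -/

theorem cross_add_left (w w' x : Fin 2 → ℝ) : cross (w + w') x = cross w x + cross w' x := by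
  simp only [cross, Pi.add_apply]; ring

theorem cross_smul_left (s : ℝ) (w x : Fin 2 → ℝ) : cross (s • w) x = s * cross w x := by
  simp only [cross, Pi.smul_apply, smul_eq_mul]; ring

theorem cross_neg_left (w x : Fin 2 → ℝ) : cross (-w) x = -cross w x := by
  simp only [cross, Pi.neg_apply]; ring

theorem cross_add_right (w x y : Fin 2 → ℝ) : cross w (x + y) = cross w x + cross w y := by
  simp only [cross, Pi.add_apply]; ring

theorem cross_sub_right (w x y : Fin 2 → ℝ) : cross w (x - y) = cross w x - cross w y := by
  simp only [cross, Pi.sub_apply]; ring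

theorem cross_smul_right (s : ℝ) (w x : Fin 2 → ℝ) : cross w (s • x) = s * cross w x := by
  simp only [cross, Pi.smul_apply, smul_eq_mul]; ring

theorem cross_self_eq_zero (w : Fin 2 → ℝ) : cross w w = 0 := by
  simp only [cross]; ring

theorem cross_swap (w x : Fin 2 → ℝ) : cross x w = -cross w x := by
  simp only [cross]; ring

/-- The vector `u` turned by a right angle, so that `cross (perp u) x` is the dot product. -/
def perp (u : Fin 2 → ℝ) : Fin 2 → ℝ := ![u 1, -u 0]

theorem cross_perp_self_pos {u : Fin 2 → ℝ} (hu : u ≠ 0) : 0 < cross (perp u) u := by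
  have h : cross (perp u) u = u 0 ^ 2 + u 1 ^ 2 := by
    simp only [cross, perp, Matrix.cons_val_zero, Matrix.cons_val_one]; ring
  rw [h]
  by_contra hn
  apply hu
  ext j
  fin_cases j
  · change u 0 = 0
    nlinarith [sq_nonneg (u 0), sq_nonneg (u 1)]
  · change u 1 = 0
    nlinarith [sq_nonneg (u 0), sq_nonneg (u 1)]

theorem eq_smul_add_smul {u v : Fin 2 → ℝ} (h : cross u v ≠ 0) (x : Fin 2 → ℝ) :
    x = (cross x v / cross u v) • u + (cross u x / cross u v) • v := by
  ext j
  fin_cases j <;> simp only [Pi.add_apply, Pi.smul_apply, smul_eq_mul] <;> field_simp <;>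
    simp only [cross] <;> simp <;> ring

theorem exists_smul_of_cross_eq_zero {u x : Fin 2 → ℝ} (hu : u ≠ 0) (h : cross u x = 0) :
    ∃ a : ℝ, x = a • u := by
  have h1 := eq_smul_add_smul (u := u) (v := perp u) (x := x)
    (by rw [cross_swap]; exact neg_ne_zero.2 (cross_perp_self_pos hu).ne')
  rw [h, zero_div, zero_smul, add_zero] at h1
  exact ⟨_, h1⟩

theorem eq_of_cross_eq {w w' x y : Fin 2 → ℝ} (h : cross w w' ≠ 0)
    (h1 : cross w x = cross w y) (h2 : cross w' x = cross w' y) : x = y := by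
  rw [eq_smul_add_smul h x, eq_smul_add_smul h y, h1, cross_swap w' x, cross_swap w' y, h2]

/-! ### Exposed pairs and vertices of a Minkowski sum -/

/-- The functional `cross w` takes its maximum over the family `p` at `i` only. -/
def IsStrictMax {ι : Type*} (w : Fin 2 → ℝ) (p : ι → Fin 2 → ℝ) (i : ι) : Prop :=
  ∀ k, k ≠ i → cross w (p k) < cross w (p i)

/-- An open half-plane together with the one point `p i` of its boundary line is convex and contains
the family. -/
theorem IsStrictMax.eq_or_lt {ι : Type*} {w : Fin 2 → ℝ} {p : ι → Fin 2 → ℝ} {i : ι}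
    (h : IsStrictMax w p i) {y : Fin 2 → ℝ} (hy : y ∈ convexHull ℝ (Set.range p)) :
    y = p i ∨ cross w y < cross w (p i) := by
  have hconv : Convex ℝ {y | y = p i ∨ cross w y < cross w (p i)} := by
    rintro x hx y hy a b ha hb hab
    have hle : ∀ z : Fin 2 → ℝ, (z = p i ∨ cross w z < cross w (p i)) →
        cross w z ≤ cross w (p i) := by
      rintro z (rfl | hz)
      exacts [le_rfl, hz.le]
    rcases ha.eq_or_lt with rfl | ha
    · rw [zero_add] at hab
      subst hab
      simpa using hy
    rcases hb.eq_or_lt with rfl | hb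
    · rw [add_zero] at hab
      subst hab
      simpa using hx
    have hb' : b = 1 - a := by linarith
    change _ ∨ cross w (a • x + b • y) < _
    rw [cross_add_right, cross_smul_right, cross_smul_right]
    have hx' := hle x hx
    have hy' := hle y hy
    rcases hx with rfl | hx
    · rcases hy with rfl | hy
      · left
        rw [← add_smul, hab, one_smul]
      · right
        subst hb'
        nlinarith
    · right
      subst hb'
      nlinarith
  refine convexHull_min ?_ hconv hy
  rintro _ ⟨k, rfl⟩
  by_cases hk : k = i
  · exact Or.inl (hk ▸ rfl)
  · exact Or.inr (h k hk)

theorem convex_cross_lt (w : Fin 2 → ℝ) (m : ℝ) : Convex ℝ {y | cross w y < m} := by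
  refine convex_halfSpace_lt ?_ m
  exact ⟨cross_add_right w, fun c x => cross_smul_right c w x⟩

/-- The pairs `(i, j)` such that some functional has its only maximum over `p` at `i` and its only
maximum over `q` at `j`. -/
def exposedPairs {ι κ : Type*} (p : ι → Fin 2 → ℝ) (q : κ → Fin 2 → ℝ) : Set (ι × κ) :=
  {x | ∃ w, IsStrictMax w p x.1 ∧ IsStrictMax w q x.2}

theorem mem_exposedPairs_swap {ι κ : Type*} {p : ι → Fin 2 → ℝ} {q : κ → Fin 2 → ℝ} {i : ι}
    {j : κ} : (j, i) ∈ exposedPairs q p ↔ (i, j) ∈ exposedPairs p q :=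
  exists_congr fun _ => and_comm

/-- Every other point of the sum lies in an open half-plane that avoids `p i + q j`, and so does
their convex hull. -/
theorem add_mem_extremePoints {ι κ : Type*} {p : ι → Fin 2 → ℝ} {q : κ → Fin 2 → ℝ} {i : ι}
    {j : κ} {w : Fin 2 → ℝ} (hi : IsStrictMax w p i) (hj : IsStrictMax w q j) :
    p i + q j ∈ (convexHull ℝ (Set.range p) + convexHull ℝ (Set.range q)).extremePoints ℝ := by
  have hc : Convex ℝ (convexHull ℝ (Set.range p) + convexHull ℝ (Set.range q)) :=
    (convex_convexHull _ _).add (convex_convexHull _ _)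
  rw [hc.mem_extremePoints_iff_mem_sdiff_convexHull_sdiff]
  refine ⟨Set.add_mem_add (subset_convexHull _ _ ⟨i, rfl⟩) (subset_convexHull _ _ ⟨j, rfl⟩), ?_⟩
  intro hmem
  have hsub : (convexHull ℝ (Set.range p) + convexHull ℝ (Set.range q)) \ {p i + q j} ⊆
      {y | cross w y < cross w (p i + q j)} := by
    rintro _ ⟨⟨x, hx, y, hy, rfl⟩, hne⟩
    change cross w (x + y) < _
    rw [cross_add_right, cross_add_right]
    rcases hi.eq_or_lt hx with rfl | hx <;> rcases hj.eq_or_lt hy with rfl | hy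
    · exact absurd rfl hne
    all_goals linarith
  exact lt_irrefl (cross w (p i + q j)) (convexHull_min hsub (convex_cross_lt _ _) hmem)

/-- Two exposed pairs with the same sum coincide: the functional exposing the first pair would be
strictly smaller on the second. -/
theorem encard_exposedPairs_le {ι κ : Type*} (p : ι → Fin 2 → ℝ) (q : κ → Fin 2 → ℝ) :
    (exposedPairs p q).encard ≤
      ((convexHull ℝ (Set.range p) + convexHull ℝ (Set.range q)).extremePoints ℝ).encard := by
  refine Set.encard_le_encard_of_injOn (f := fun x => p x.1 + q x.2) ?_ ?_
  · rintro ⟨i, j⟩ ⟨w, hi, hj⟩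
    exact add_mem_extremePoints hi hj
  · rintro ⟨i, j⟩ ⟨w, hi, hj⟩ ⟨i', j'⟩ - h
    have h' : cross w (p i) + cross w (q j) = cross w (p i') + cross w (q j') := by
      rw [← cross_add_right, ← cross_add_right]
      exact congrArg _ h
    by_cases h1 : i' = i <;> by_cases h2 : j' = j
    · rw [h1, h2]
    · subst h1
      have := hj _ h2
      linarith
    · subst h2
      have := hi _ h1
      linarith
    · have := hi _ h1
      have := hj _ h2
      linarith

/-- The lexicographic maximum of the pair of functionals `cross w`, `cross w'` over the family `p`
is at `i` only. -/
def IsLexMax {ι : Type*} (w w' : Fin 2 → ℝ) (p : ι → Fin 2 → ℝ) (i : ι) : Prop :=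
  ∀ k, k ≠ i → cross w (p k) < cross w (p i) ∨
    (cross w (p k) = cross w (p i) ∧ cross w' (p k) < cross w' (p i))

theorem IsStrictMax.isLexMax {ι : Type*} {w : Fin 2 → ℝ} {p : ι → Fin 2 → ℝ} {i : ι}
    (h : IsStrictMax w p i) (w' : Fin 2 → ℝ) : IsLexMax w w' p i := fun k hk => Or.inl (h k hk)

/-- A small positive multiple of `w'` breaks the ties of `w` without reversing its finitely many
strict inequalities. -/
theorem IsLexMax.eventually {ι : Type*} [Finite ι] {w w' : Fin 2 → ℝ} {p : ι → Fin 2 → ℝ} {i : ι}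
    (h : IsLexMax w w' p i) :
    ∀ᶠ ε : ℝ in nhdsWithin 0 (Set.Ioi 0), IsStrictMax (w + ε • w') p i := by
  refine Filter.eventually_all.2 fun k => ?_
  by_cases hk : k = i
  · exact Filter.Eventually.of_forall fun _ h => absurd hk h
  simp only [cross_add_left, cross_smul_left]
  rcases h k hk with h | ⟨h1, h2⟩
  · have hc : ∀ x : Fin 2 → ℝ, Continuous fun ε : ℝ => cross w x + ε * cross w' x := fun x =>
      continuous_const.add (continuous_id.mul continuous_const)
    have := (isOpen_lt (hc (p k)) (hc (p i))).mem_nhds (x := 0) (by simpa using h)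
    filter_upwards [mem_nhdsWithin_of_mem_nhds this] with ε hε _ using hε
  · filter_upwards [self_mem_nhdsWithin] with ε hε _
    rw [h1]
    have := mul_lt_mul_of_pos_left h2 (Set.mem_Ioi.1 hε)
    linarith

theorem mem_exposedPairs_of_isLexMax {ι κ : Type*} [Finite ι] [Finite κ] {w w' : Fin 2 → ℝ}
    {p : ι → Fin 2 → ℝ} {q : κ → Fin 2 → ℝ} {i : ι} {j : κ} (hi : IsLexMax w w' p i)
    (hj : IsLexMax w w' q j) : (i, j) ∈ exposedPairs p q := by
  obtain ⟨ε, h1, h2⟩ := (hi.eventually.and hj.eventually).exists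
  exact ⟨_, h1, h2⟩

theorem exists_isLexMax {ι : Type*} [Finite ι] [Nonempty ι] {w w' : Fin 2 → ℝ}
    (hw : cross w w' ≠ 0) {p : ι → Fin 2 → ℝ} (hp : Function.Injective p) :
    ∃ i, IsLexMax w w' p i := by
  obtain ⟨i, hi⟩ := Finite.exists_max fun i => toLex (cross w (p i), cross w' (p i))
  refine ⟨i, fun k hk => ?_⟩
  have h1 := hi k
  rw [Prod.Lex.toLex_le_toLex] at h1
  rcases h1 with h1 | ⟨h1, h2⟩
  · exact Or.inl h1
  · refine Or.inr ⟨h1, lt_of_le_of_ne h2 fun h3 => hk (hp (eq_of_cross_eq hw h1 h3))⟩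

theorem cross_perp_ne_zero {w : Fin 2 → ℝ} (hw : w ≠ 0) : cross w (perp w) ≠ 0 := by
  rw [cross_swap]
  exact neg_ne_zero.2 (cross_perp_self_pos hw).ne'

/-- Ties over `q` are broken by tilting `w` towards `perp w`, which does not disturb the strict
maximum over `p`. -/
theorem IsStrictMax.exists_mem_exposedPairs {ι κ : Type*} [Finite ι] [Finite κ] [Nonempty κ]
    {w : Fin 2 → ℝ} (hw : w ≠ 0) {p : ι → Fin 2 → ℝ} {i : ι} (hi : IsStrictMax w p i)
    {q : κ → Fin 2 → ℝ} (hq : Function.Injective q) :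
    ∃ j, (i, j) ∈ exposedPairs p q ∧ ∀ k, cross w (q k) ≤ cross w (q j) := by
  obtain ⟨j, hj⟩ := exists_isLexMax (cross_perp_ne_zero hw) hq
  refine ⟨j, mem_exposedPairs_of_isLexMax (hi.isLexMax _) hj, fun k => ?_⟩
  by_cases hk : k = j
  · rw [hk]
  · rcases hj k hk with h | h
    exacts [h.le, h.1.le]

/-! ### Triangles, their normals and the number of exposed pairs -/

/-- Twice the signed area of the triangle `p`. -/
def area (p : Fin 3 → Fin 2 → ℝ) : ℝ := cross (p 1 - p 0) (p 2 - p 0)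

/-- The normal of a triangle at the edge opposite to the vertex `i`, scaled so that the vertex has
distance `1` from the edge. -/
def normal (p : Fin 3 → Fin 2 → ℝ) (i : Fin 3) : Fin 2 → ℝ :=
  (area p)⁻¹ • (p (i + 1) - p (i + 2))

/-- Both other vertices get the same value, larger than the value at `i`, so `normal p i` is an
outer normal of the edge opposite to `i`. -/
theorem cross_normal {p : Fin 3 → Fin 2 → ℝ} (hp : area p ≠ 0) {i k : Fin 3} (hk : k ≠ i) :
    cross (normal p i) (p k) = cross (normal p i) (p i) + 1 := by
  have key : cross (p (i + 1) - p (i + 2)) (p k) =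
      cross (p (i + 1) - p (i + 2)) (p i) + area p := by
    fin_cases i <;> fin_cases k <;> first | exact absurd rfl hk | skip
    all_goals
      simp [area, cross]
      ring
  rw [normal, cross_smul_left, cross_smul_left, key, mul_add, inv_mul_cancel₀ hp]

theorem normal_ne_zero {p : Fin 3 → Fin 2 → ℝ} (hp : area p ≠ 0) (i : Fin 3) :
    normal p i ≠ 0 := by
  intro h
  obtain ⟨k, hk⟩ : ∃ k, k ≠ i := exists_ne i
  have := cross_normal hp hk
  rw [h] at this
  simp [cross] at this

/-- The edge vectors of a triangle add up to zero. -/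
theorem sum_cross_normal (p : Fin 3 → Fin 2 → ℝ) (x : Fin 2 → ℝ) :
    ∑ i, cross (normal p i) x = 0 := by
  simp only [Fin.sum_univ_three, normal, cross_smul_left]
  simp only [cross, Pi.sub_apply, zero_add, show (1 : Fin 3) + 1 = 2 from rfl,
    show (1 : Fin 3) + 2 = 0 from rfl, show (2 : Fin 3) + 1 = 0 from rfl,
    show (2 : Fin 3) + 2 = 1 from rfl]
  ring

theorem exists_third {i k : Fin 3} (h : i ≠ k) :
    ∃ l, l ≠ i ∧ l ≠ k ∧ ∀ m, m = i ∨ m = k ∨ m = l := by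
  revert i k; decide

theorem exists_two_others (i : Fin 3) : ∃ k l : Fin 3, k ≠ i ∧ l ≠ i ∧ k ≠ l := by
  revert i; decide

theorem cross_normal_normal {p : Fin 3 → Fin 2 → ℝ} (hp : area p ≠ 0) {i k : Fin 3} (hk : k ≠ i) :
    cross (normal p i) (normal p k) ≠ 0 := by
  intro h
  obtain ⟨a, ha⟩ := exists_smul_of_cross_eq_zero (normal_ne_zero hp i) h
  obtain ⟨l, h2, h1, -⟩ := exists_third hk
  have e1 := cross_normal hp h2
  have e2 := cross_normal hp hk.symm
  rw [ha, cross_smul_left, cross_smul_left] at e1 e2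
  have e3 := cross_normal hp h1
  have e4 := cross_normal hp hk
  rw [e3, e4] at e1
  linarith

theorem injective_of_area_ne_zero {p : Fin 3 → Fin 2 → ℝ} (hp : area p ≠ 0) :
    Function.Injective p := by
  intro i k h
  by_contra hik
  have := cross_normal hp (Ne.symm hik)
  rw [h] at this
  linarith

theorem isStrictMax_neg_normal {p : Fin 3 → Fin 2 → ℝ} (hp : area p ≠ 0) (i : Fin 3) :
    IsStrictMax (-normal p i) p i := by
  intro k hk
  rw [cross_neg_left, cross_neg_left, cross_normal hp hk]
  linarith

/-- The functional `normal p i` is maximal along a whole edge of `p`; tilting it slightly towards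
either end exposes that end and leaves the strict maximum `j` in place. -/
theorem IsStrictMax.mem_exposedPairs_of_normal {κ : Type*} [Finite κ] {p : Fin 3 → Fin 2 → ℝ}
    (hp : area p ≠ 0) {q : κ → Fin 2 → ℝ} {i : Fin 3} {j : κ} (h : IsStrictMax (normal p i) q j)
    {k : Fin 3} (hk : k ≠ i) : (k, j) ∈ exposedPairs p q := by
  obtain ⟨l, hlk, -, hl⟩ := exists_third hk
  have hne : p k - p l ≠ 0 := sub_ne_zero.2 ((injective_of_area_ne_zero hp).ne hlk.symm)
  refine mem_exposedPairs_of_isLexMax (w' := perp (p k - p l)) (fun m hm => ?_) (h.isLexMax _)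
  rcases eq_or_ne m i with rfl | hmi
  · left
    rw [cross_normal hp hk]
    linarith
  · right
    have hml := ((hl m).resolve_left hm).resolve_left hmi
    refine ⟨by rw [cross_normal hp hk, cross_normal hp hmi], ?_⟩
    rw [hml]
    have := cross_perp_self_pos hne
    rw [cross_sub_right] at this
    linarith

theorem exists_mem_exposedPairs {κ : Type*} [Finite κ] [Nonempty κ] {p : Fin 3 → Fin 2 → ℝ}
    (hp : area p ≠ 0) {q : κ → Fin 2 → ℝ} (hq : Function.Injective q) (i : Fin 3) :
    ∃ j, (i, j) ∈ exposedPairs p q := by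
  obtain ⟨j, hj, -⟩ := (isStrictMax_neg_normal hp i).exists_mem_exposedPairs
    (neg_ne_zero.2 (normal_ne_zero hp i)) hq
  exact ⟨j, hj⟩

theorem four_le_encard {α : Type*} {s : Set α} {a b c d : α} (ha : a ∈ s) (hb : b ∈ s)
    (hc : c ∈ s) (hd : d ∈ s) (hab : a ≠ b) (hac : a ≠ c) (had : a ≠ d) (hbc : b ≠ c)
    (hbd : b ≠ d) (hcd : c ≠ d) : 4 ≤ s.encard := by
  have hsub : ({a, b, c, d} : Set α) ⊆ s := by
    rintro x (rfl | rfl | rfl | rfl) <;> assumption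
  refine le_trans (le_of_eq ?_) (Set.encard_le_encard hsub)
  rw [Set.encard_insert_of_notMem (by simp [hab, hac, had]),
    Set.encard_insert_of_notMem (by simp [hbc, hbd]), Set.encard_pair hcd]
  norm_num

/-- Two triangles whose normals are not all common have at least four exposed pairs. -/
theorem four_le_encard_exposedPairs {p q : Fin 3 → Fin 2 → ℝ} (hp : area p ≠ 0) (hq : area q ≠ 0)
    {i j : Fin 3} (h : IsStrictMax (normal p i) q j) : 4 ≤ (exposedPairs p q).encard := by
  obtain ⟨k, k', hk, hk', hkk⟩ := exists_two_others i
  obtain ⟨l, l', hl, hl', hll⟩ := exists_two_others j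
  obtain ⟨m, hm⟩ := exists_mem_exposedPairs hq (injective_of_area_ne_zero hp) l
  obtain ⟨m', hm'⟩ := exists_mem_exposedPairs hq (injective_of_area_ne_zero hp) l'
  -- The edge normal pairs `j` with two vertices of `p`, and each of the two other vertices of `q`
  -- occurs in some pair of its own.
  refine four_le_encard (h.mem_exposedPairs_of_normal hp hk) (h.mem_exposedPairs_of_normal hp hk')
    (mem_exposedPairs_swap.1 hm) (mem_exposedPairs_swap.1 hm') ?_ ?_ ?_ ?_ ?_ ?_ <;>
    simp [hkk, hl.symm, hl'.symm, hll]

/-- `Q i` stands for the vertex of `q` exposed by the normal of `p` at `i`, and `P j` for the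
reverse; each normal yields two pairs. The bound is checked over all pairs of maps. Two constant
maps would give only five pairs. -/
theorem six_le_card_incidences (P Q : Fin 3 → Fin 3) (hP : ∃ i k, P i ≠ P k)
    (hQ : ∃ i k, Q i ≠ Q k) :
    6 ≤ (Finset.univ.filter fun x : Fin 3 × Fin 3 =>
      (∃ i, i ≠ x.1 ∧ Q i = x.2) ∨ (∃ j, j ≠ x.2 ∧ P j = x.1)).card := by
  revert P Q
  decide +kernel

/-- If one vertex were strictly maximal for all three normals, summing the inequalities would give 0
< 0, since the normals add up to zero. -/
theorem not_const_of_isStrictMax_normal {p q : Fin 3 → Fin 2 → ℝ} {Q : Fin 3 → Fin 3}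
    (h : ∀ i, IsStrictMax (normal p i) q (Q i)) : ∃ i k, Q i ≠ Q k := by
  by_contra! hc
  obtain ⟨l, hl⟩ : ∃ l, l ≠ Q 0 := exists_ne _
  have h1 : ∑ i, cross (normal p i) (q l) < ∑ i, cross (normal p i) (q (Q 0)) :=
    Finset.sum_lt_sum_of_nonempty Finset.univ_nonempty fun i _ => by
      rw [hc 0 i]
      exact h i l (hc 0 i ▸ hl)
  rw [sum_cross_normal, sum_cross_normal] at h1
  exact lt_irrefl _ h1

/-- Two triangles without a common normal have at least six exposed pairs. -/
theorem six_le_encard_exposedPairs {p q : Fin 3 → Fin 2 → ℝ} (hp : area p ≠ 0) (hq : area q ≠ 0)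
    (h₁ : ∀ i, ∃ j, IsStrictMax (normal p i) q j) (h₂ : ∀ j, ∃ i, IsStrictMax (normal q j) p i) :
    6 ≤ (exposedPairs p q).encard := by
  choose Q hQ using h₁
  choose P hP using h₂
  have h := six_le_card_incidences P Q (not_const_of_isStrictMax_normal hP)
    (not_const_of_isStrictMax_normal hQ)
  have h' : (6 : ℕ∞) ≤ ((Finset.univ.filter fun x : Fin 3 × Fin 3 =>
      (∃ i, i ≠ x.1 ∧ Q i = x.2) ∨ (∃ j, j ≠ x.2 ∧ P j = x.1)).card : ℕ∞) := by exact_mod_cast h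
  refine h'.trans ?_
  rw [← Set.encard_coe_eq_coe_finsetCard]
  refine Set.encard_le_encard ?_
  rintro ⟨k, l⟩ hkl
  simp only [Finset.coe_filter, Finset.mem_univ, true_and, Set.mem_ofPred_eq] at hkl
  rcases hkl with ⟨i, hi, rfl⟩ | ⟨j, hj, rfl⟩
  · exact (hQ i).mem_exposedPairs_of_normal hp hi.symm
  · exact mem_exposedPairs_swap.1 ((hP j).mem_exposedPairs_of_normal hq hj.symm)

theorem exists_eq_max_of_not_isStrictMax {ι : Type*} [Finite ι] [Nonempty ι] {w : Fin 2 → ℝ}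
    {q : ι → Fin 2 → ℝ} (h : ¬∃ j, IsStrictMax w q j) :
    ∃ j k, j ≠ k ∧ cross w (q j) = cross w (q k) ∧ ∀ l, cross w (q l) ≤ cross w (q j) := by
  obtain ⟨j, hj⟩ := Finite.exists_max fun j => cross w (q j)
  push Not at h
  have h1 := h j
  rw [IsStrictMax] at h1
  push Not at h1
  obtain ⟨k, hk, hle⟩ := h1
  exact ⟨j, k, hk.symm, le_antisymm hle (hj k), hj⟩

/-- Two triangles whose normals are all common are homothetic. -/
theorem exists_homothety {p q : Fin 3 → Fin 2 → ℝ} (hp : area p ≠ 0) (hq : area q ≠ 0)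
    (h : ∀ i, ¬∃ j, IsStrictMax (normal p i) q j) :
    ∃ (σ : Equiv.Perm (Fin 3)) (l : ℝ), q (σ 1) - q (σ 0) = l • (p 1 - p 0) ∧
      q (σ 2) - q (σ 0) = l • (p 2 - p 0) := by
  -- The maximum `M` over `q` is attained at two vertices; `s` is the third one and `δ` its depth
  -- below them, positive because `q` is not collinear.
  have key : ∀ i, ∃ (s : Fin 3) (M δ : ℝ), 0 < δ ∧
      ∀ k, cross (normal p i) (q k) = M - if s = k then δ else 0 := by
    intro i
    obtain ⟨j, k, hjk, heq, hmax⟩ := exists_eq_max_of_not_isStrictMax (h i)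
    obtain ⟨s, hsj, hsk, hs⟩ := exists_third hjk
    refine ⟨s, cross (normal p i) (q j), cross (normal p i) (q j) - cross (normal p i) (q s), ?_,
      fun m => ?_⟩
    · refine sub_pos.2 (lt_of_le_of_ne (hmax s) fun he => hq ?_)
      have hall : ∀ m, cross (normal p i) (q m) = cross (normal p i) (q j) := by
        intro m
        rcases hs m with rfl | rfl | rfl
        exacts [rfl, heq.symm, he]
      have hz : ∀ m, ∃ a : ℝ, q m - q 0 = a • normal p i := fun m =>
        exists_smul_of_cross_eq_zero (normal_ne_zero hp i) (by
          rw [cross_sub_right, hall, hall 0, sub_self])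
      obtain ⟨a, ha⟩ := hz 1
      obtain ⟨b, hb⟩ := hz 2
      rw [area, ha, hb, cross_smul_left, cross_smul_right, cross_self_eq_zero, mul_zero, mul_zero]
    · rcases hs m with rfl | rfl | rfl
      · rw [if_neg hsj, sub_zero]
      · rw [if_neg hsk, sub_zero, heq]
      · rw [if_pos rfl, sub_sub_cancel]
  choose s M δ hδ hs using key
  -- The normals add up to zero at `q k`. The left side does not depend on `k` and is positive at `k
  -- = s 0`, so `s` must hit every vertex; then all depths equal this common sum, which is the ratio
  -- of the homothety.
  have hsum : ∀ k, ∑ i, M i = ∑ i, if s i = k then δ i else 0 := by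
    intro k
    have := sum_cross_normal p (q k)
    simp only [hs, Finset.sum_sub_distrib] at this
    linarith
  have hsurj : Function.Surjective s := by
    intro k
    by_contra! hk
    have h1 := hsum k
    simp only [hk, if_false, Finset.sum_const_zero] at h1
    have h2 := hsum (s 0)
    have h3 : (0 : ℝ) < ∑ i, if s i = s 0 then δ i else 0 :=
      Finset.sum_pos' (fun i _ => by split_ifs; exacts [(hδ i).le, le_rfl])
        ⟨0, Finset.mem_univ _, by simpa using hδ 0⟩
    linarith
  have hbij : Function.Bijective s := Finite.injective_iff_bijective.1
    (Finite.injective_iff_surjective.2 hsurj)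
  have hδ' : ∀ i, δ i = ∑ i, M i := by
    intro i
    rw [hsum (s i)]
    simp [hbij.injective.eq_iff]
  have hval : ∀ i k, k ≠ i → cross (normal p i) (q (s k)) =
      cross (normal p i) (q (s i)) + ∑ i, M i := by
    intro i k hk
    rw [hs, hs, if_neg (hbij.injective.ne hk.symm), if_pos rfl, hδ' i]
    ring
  have hfin : ∀ k, q (s k) - q (s 0) = (∑ i, M i) • (p k - p 0) := by
    intro k
    have hc : ∀ i, cross (normal p i) (q (s k) - q (s 0)) =
        cross (normal p i) ((∑ i, M i) • (p k - p 0)) := by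
      intro i
      rw [cross_smul_right, cross_sub_right, cross_sub_right]
      rcases eq_or_ne k i with hk | hk <;> rcases eq_or_ne 0 i with h0 | h0
      · rw [hk, ← h0]; ring
      · rw [hk, hval _ _ h0, cross_normal hp h0]; ring
      · subst h0; rw [hval _ _ hk, cross_normal hp hk]; ring
      · rw [hval _ _ h0, cross_normal hp h0, hval _ _ hk, cross_normal hp hk]; ring
    exact eq_of_cross_eq (cross_normal_normal hp (i := 0) (k := 1) (by decide)) (hc 0) (hc 1)
  exact ⟨Equiv.ofBijective s hbij, _, hfin 1, hfin 2⟩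

theorem exists_isStrictMax_of_injective {ι : Type*} [Finite ι] [Nonempty ι] {w : Fin 2 → ℝ}
    {q : ι → Fin 2 → ℝ} (h : Function.Injective fun j => cross w (q j)) :
    ∃ j, IsStrictMax w q j := by
  by_contra hn
  obtain ⟨j, k, hjk, heq, -⟩ := exists_eq_max_of_not_isStrictMax hn
  exact hjk (h heq)

/-- A collinear family is parametrized by reals. -/
theorem exists_smul_of_area_eq_zero {p : Fin 3 → Fin 2 → ℝ} (hp : area p = 0)
    (hinj : Function.Injective p) :
    ∃ r : Fin 3 → ℝ, r 0 = 0 ∧ r 1 = 1 ∧ Function.Injective r ∧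
      ∀ i, p i = p 0 + r i • (p 1 - p 0) := by
  have hu : p 1 - p 0 ≠ 0 := sub_ne_zero.2 (hinj.ne (by decide))
  obtain ⟨a, ha⟩ := exists_smul_of_cross_eq_zero hu hp
  have h : ∀ i, p i = p 0 + (![0, 1, a] : Fin 3 → ℝ) i • (p 1 - p 0) := by
    intro i
    fin_cases i
    · simp
    · simp
    · simp [← ha]
  refine ⟨![0, 1, a], rfl, rfl, fun i k hik => hinj ?_, h⟩
  rw [h i, h k, hik]

/-- A triangle and a segment have at least four exposed pairs. -/
theorem four_le_encard_exposedPairs_of_segment {p q : Fin 3 → Fin 2 → ℝ} (hp : area p ≠ 0)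
    (hq : area q = 0) (hinj : Function.Injective q) : 4 ≤ (exposedPairs p q).encard := by
  obtain ⟨r, -, -, hr, hqr⟩ := exists_smul_of_area_eq_zero hq hinj
  set v := q 1 - q 0 with hv
  have hv0 : v ≠ 0 := sub_ne_zero.2 (hinj.ne (by decide))
  have hinj' : ∀ i, cross (normal p i) v ≠ 0 →
      Function.Injective fun j => cross (normal p i) (q j) := by
    intro i hi j k hjk
    simp only [hqr j, hqr k, cross_add_right, cross_smul_right] at hjk
    exact hr (mul_right_cancel₀ hi (add_left_cancel hjk))
  -- Two different normals are independent and cannot both vanish on `v`, so at least two of the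
  -- three are nonconstant along the segment.
  obtain ⟨i, k, hik, hi, hk⟩ : ∃ i k, i ≠ k ∧ cross (normal p i) v ≠ 0 ∧
      cross (normal p k) v ≠ 0 := by
    by_contra! hc
    have hpar : ∀ i k, i ≠ k → cross (normal p i) v = 0 → cross (normal p k) v ≠ 0 := by
      intro i k hik h1 h2
      have h0 : ∀ w : Fin 2 → ℝ, cross w 0 = 0 := fun w => by simp [cross]
      exact hv0 (eq_of_cross_eq (cross_normal_normal hp hik.symm) (h1.trans (h0 _).symm)
        (h2.trans (h0 _).symm))
    by_cases h0 : cross (normal p 0) v = 0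
    · exact hpar 0 2 (by decide) h0 (hc 1 2 (by decide) (hpar 0 1 (by decide) h0))
    · exact hpar 1 2 (by decide) (hc 0 1 (by decide) h0) (hc 0 2 (by decide) h0)
  obtain ⟨j, hj⟩ := exists_isStrictMax_of_injective (hinj' i hi)
  obtain ⟨l, hl⟩ := exists_isStrictMax_of_injective (hinj' k hk)
  obtain ⟨m, hmi, hmk, -⟩ := exists_third hik
  -- If both normals expose the same end `j`, then `j` pairs with all three vertices of `p`, and the
  -- functional `-normal p i` supplies a pair with another index of `q`.
  by_cases hjl : j = l
  · subst hjl
    obtain ⟨j', hj', hmax⟩ := (isStrictMax_neg_normal hp i).exists_mem_exposedPairs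
      (neg_ne_zero.2 (normal_ne_zero hp i)) hinj
    have hne : j' ≠ j := by
      rintro rfl
      obtain ⟨n, hn⟩ := exists_ne j'
      have h1 := hmax n
      have h2 := hj n hn
      rw [cross_neg_left, cross_neg_left] at h1
      linarith
    refine four_le_encard (hj.mem_exposedPairs_of_normal hp hik.symm)
      (hj.mem_exposedPairs_of_normal hp hmi) (hl.mem_exposedPairs_of_normal hp hik) hj'
      ?_ ?_ ?_ ?_ ?_ ?_ <;> simp [hik.symm, hmk.symm, hmi, hne.symm]
  · refine four_le_encard (hj.mem_exposedPairs_of_normal hp hik.symm)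
      (hj.mem_exposedPairs_of_normal hp hmi) (hl.mem_exposedPairs_of_normal hp hik)
      (hl.mem_exposedPairs_of_normal hp hmk)
      ?_ ?_ ?_ ?_ ?_ ?_ <;> simp [hjl, hmk.symm, hmi.symm]

/-- Two non-parallel segments have at least four exposed pairs. -/
theorem four_le_encard_exposedPairs_of_segments {p q : Fin 3 → Fin 2 → ℝ}
    (hp : area p = 0) (hpinj : Function.Injective p) (hq : area q = 0)
    (hqinj : Function.Injective q) (h : cross (p 1 - p 0) (q 1 - q 0) ≠ 0) :
    4 ≤ (exposedPairs p q).encard := by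
  obtain ⟨r, -, -, hr, hpr⟩ := exists_smul_of_area_eq_zero hp hpinj
  obtain ⟨s, -, -, hs, hqs⟩ := exists_smul_of_area_eq_zero hq hqinj
  set u := p 1 - p 0
  set v := q 1 - q 0
  -- Values on the independent vectors `u` and `v` can be prescribed; the four sign choices expose
  -- the four combinations of ends.
  have hw : ∀ a b : ℝ, ∃ w, cross w u = a ∧ cross w v = b := by
    intro a b
    refine ⟨(b / cross u v) • u + (-a / cross u v) • v, ?_, ?_⟩
    · rw [cross_add_left, cross_smul_left, cross_smul_left, cross_self_eq_zero, cross_swap u v]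
      field_simp
      ring
    · rw [cross_add_left, cross_smul_left, cross_smul_left, cross_self_eq_zero]
      field_simp
      ring
  have hext : ∀ r : Fin 3 → ℝ, Function.Injective r → ∀ e : ℝ, e ≠ 0 →
      ∃ i, ∀ k, k ≠ i → r k * e < r i * e := by
    intro r hr e he
    obtain ⟨i, hi⟩ := Finite.exists_max fun i => r i * e
    exact ⟨i, fun k hk => lt_of_le_of_ne (hi k) fun h => hk (hr (mul_right_cancel₀ he h))⟩
  have hmem : ∀ a b : ℝ, ∀ i j : Fin 3, (∀ k, k ≠ i → r k * a < r i * a) →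
      (∀ k, k ≠ j → s k * b < s j * b) → (i, j) ∈ exposedPairs p q := by
    intro a b i j hi hj
    obtain ⟨w, hw1, hw2⟩ := hw a b
    refine ⟨w, fun k hk => ?_, fun k hk => ?_⟩
    · change cross w (p k) < cross w (p i)
      rw [hpr k, hpr i, cross_add_right, cross_add_right, cross_smul_right, cross_smul_right, hw1]
      exact add_lt_add_right (hi k hk) _
    · change cross w (q k) < cross w (q j)
      rw [hqs k, hqs j, cross_add_right, cross_add_right, cross_smul_right, cross_smul_right, hw2]
      exact add_lt_add_right (hj k hk) _
  have hne : ∀ (r : Fin 3 → ℝ) (i i' : Fin 3), (∀ k, k ≠ i → r k * 1 < r i * 1) →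
      (∀ k, k ≠ i' → r k * (-1) < r i' * (-1)) → i ≠ i' := by
    rintro r i _ h1 h2 rfl
    obtain ⟨k, hk⟩ := exists_ne i
    have := h1 k hk
    have := h2 k hk
    linarith
  obtain ⟨i, hi⟩ := hext r hr 1 one_ne_zero
  obtain ⟨i', hi'⟩ := hext r hr (-1) (by norm_num)
  obtain ⟨j, hj⟩ := hext s hs 1 one_ne_zero
  obtain ⟨j', hj'⟩ := hext s hs (-1) (by norm_num)
  have h1 := hne r i i' hi hi'
  have h2 := hne s j j' hj hj'
  refine four_le_encard (hmem _ _ i j hi hj) (hmem _ _ i j' hi hj') (hmem _ _ i' j hi' hj)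
    (hmem _ _ i' j' hi' hj') ?_ ?_ ?_ ?_ ?_ ?_ <;> simp [h1, h2]

/-! ### Upper bounds for indexed trinomials and for fewnomial systems -/

theorem exists_tri {f : Fewnomial 2} (hf : f.supp.card = 3) :
    ∃ (c : Fin 3 → ℝ) (p : Fin 3 → Fin 2 → ℝ), (∀ i, c i ≠ 0) ∧ Function.Injective p ∧
      (f.supp : Set (Fin 2 → ℝ)) = Set.range p ∧ f.eval = tri c p := by
  let e := f.supp.equivFinOfCardEq hf
  refine ⟨fun i => f.coeff (e.symm i), fun i => e.symm i, fun i => ?_, ?_, ?_, ?_⟩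
  · exact Finsupp.mem_support_iff.1 (e.symm i).2
  · exact Subtype.val_injective.comp e.symm.injective
  · ext a
    constructor
    · intro ha
      exact ⟨e ⟨a, ha⟩, by simp⟩
    · rintro ⟨i, rfl⟩
      exact (e.symm i).2
  · ext x
    rw [Fewnomial.eval, tri, ← Finset.sum_coe_sort]
    exact (e.symm.sum_comp fun a => f.coeff a.1 * mon a.1 x).symm

theorem isolatedPosZeros_eq {F : FewnomialSystem 2 2} {f g : (Fin 2 → ℝ) → ℝ}
    (h₀ : (F 0).eval = f) (h₁ : (F 1).eval = g) :
    F.isolatedPosZeros = arcIsolated (posCommonZeros f g) := by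
  have : F.posZeros = posCommonZeros f g := by
    ext x
    rw [FewnomialSystem.posZeros, posCommonZeros, Set.mem_ofPred_eq, Set.mem_ofPred_eq,
      Fin.forall_fin_two (p := fun i => (F i).eval x = 0), h₀, h₁]
  rw [FewnomialSystem.isolatedPosZeros, this]
  rfl

section Bounds

variable {c d : Fin 3 → ℝ} {p q : Fin 3 → Fin 2 → ℝ}

theorem area_comp_ne_zero (hp : area p ≠ 0) (σ : Equiv.Perm (Fin 3)) : area (p ∘ σ) ≠ 0 := by
  have h : area (p ∘ σ) = area p ∨ area (p ∘ σ) = -area p := by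
    obtain ⟨h0, h1, h2⟩ : σ 0 ≠ σ 1 ∧ σ 0 ≠ σ 2 ∧ σ 1 ≠ σ 2 :=
      ⟨σ.injective.ne (by decide), σ.injective.ne (by decide), σ.injective.ne (by decide)⟩
    simp only [area, Function.comp_apply]
    generalize σ 0 = i at *
    generalize σ 1 = j at *
    generalize σ 2 = k at *
    fin_cases i <;> fin_cases j <;> fin_cases k <;> simp at h0 h1 h2 <;> simp [cross] <;>
      first | (left; ring1) | (right; ring1)
  rcases h with h | h <;> rw [h]
  exacts [hp, neg_ne_zero.2 hp]

theorem encard_arcIsolated_le_two_of_homothety (hc : ∀ i, c i ≠ 0) (hp : area p ≠ 0)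
    {σ : Equiv.Perm (Fin 3)} {l : ℝ} (h₁ : q (σ 1) - q (σ 0) = l • (p 1 - p 0))
    (h₂ : q (σ 2) - q (σ 0) = l • (p 2 - p 0)) :
    (arcIsolated (posCommonZeros (tri c p) (tri d q))).encard ≤ 2 := by
  have hd : tri d q = tri (d ∘ σ) (q ∘ σ) := funext fun x => (tri_perm d q σ x).symm
  rw [hd]
  refine encard_arcIsolated_le (n := 2) (hc 2) hp (a₁ := l) (b₁ := 0) (a₂ := 0) (b₂ := l) ?_ ?_ ?_
  · simpa using h₁
  · simpa using h₂
  · simpa using zerosLE_two_of_homothetic _ _ ((d ∘ σ) 0) ((d ∘ σ) 1) ((d ∘ σ) 2) l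

theorem exists_perm_apply {j k : Fin 3} (hjk : j ≠ k) :
    ∃ τ : Equiv.Perm (Fin 3), τ 0 = j ∧ τ 1 = k := by
  refine ⟨Equiv.swap 0 j * Equiv.swap 1 (Equiv.swap 0 j k), ?_, ?_⟩
  · have h0 : (0 : Fin 3) ≠ Equiv.swap 0 j k := by
      intro h0
      rw [eq_comm, Equiv.swap_apply_eq_iff, Equiv.swap_apply_left] at h0
      exact hjk h0.symm
    rw [Equiv.Perm.mul_apply, Equiv.swap_apply_of_ne_of_ne (by decide) h0,
      Equiv.swap_apply_left]
  · rw [Equiv.Perm.mul_apply, Equiv.swap_apply_left, Equiv.swap_apply_self]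

/-- Parallelism removes the power of `α + β * t` from the `d 1` term, leaving the pure power `t ^ a`
that `zerosLE_four_of_edge` requires. -/
theorem encard_arcIsolated_le_four_of_first_edge (hc : ∀ i, c i ≠ 0) (hp : area p ≠ 0) {a : ℝ}
    (h : q 1 - q 0 = a • (p 1 - p 0)) :
    (arcIsolated (posCommonZeros (tri c p) (tri d q))).encard ≤ 4 := by
  have h1 : q 1 - q 0 = a • (p 1 - p 0) + (0 : ℝ) • (p 2 - p 0) := by
    rw [h, zero_smul, add_zero]
  have h2 := eq_smul_add_smul hp (q 2 - q 0)
  refine encard_arcIsolated_le (n := 4) (hc 2) hp h1 h2 ?_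
  simp only [Real.rpow_zero, mul_one]
  exact zerosLE_four_of_edge (-c 0 / c 2) (-c 1 / c 2) (d 0) (d 1) (d 2) a _ _

/-- Two trinomials whose Newton triangles have two parallel edges. -/
theorem encard_arcIsolated_le_four_of_edge (hc : ∀ i, c i ≠ 0) (hp : area p ≠ 0) {i j k : Fin 3}
    (hjk : j ≠ k) (h : cross (normal p i) (q j) = cross (normal p i) (q k)) :
    (arcIsolated (posCommonZeros (tri c p) (tri d q))).encard ≤ 4 := by
  -- Reordering the terms makes the two parallel edges join the vertices numbered 0 and 1.
  obtain ⟨σ, hσ⟩ : ∃ σ : Equiv.Perm (Fin 3), σ 2 = i := ⟨Equiv.swap 2 i, by simp⟩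
  obtain ⟨τ, hτ0, hτ1⟩ := exists_perm_apply hjk
  have e1 : tri c p = tri (c ∘ σ) (p ∘ σ) := funext fun x => (tri_perm c p σ x).symm
  have e2 : tri d q = tri (d ∘ τ) (q ∘ τ) := funext fun x => (tri_perm d q τ x).symm
  rw [e1, e2]
  have hσi : ∀ m, m ≠ 2 → σ m ≠ i := fun m hm => hσ ▸ σ.injective.ne hm
  obtain ⟨a, ha⟩ := exists_smul_of_cross_eq_zero (normal_ne_zero hp i)
    (x := (q ∘ τ) 1 - (q ∘ τ) 0) (by
      rw [cross_sub_right, Function.comp_apply, Function.comp_apply, hτ0, hτ1, h, sub_self])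
  obtain ⟨b, hb⟩ := exists_smul_of_cross_eq_zero (normal_ne_zero hp i)
    (x := (p ∘ σ) 1 - (p ∘ σ) 0) (by
      rw [cross_sub_right, Function.comp_apply, Function.comp_apply,
        cross_normal hp (hσi 1 (by decide)), cross_normal hp (hσi 0 (by decide)), sub_self])
  have hb0 : b ≠ 0 := by
    rintro rfl
    rw [zero_smul, sub_eq_zero] at hb
    exact absurd (injective_of_area_ne_zero (area_comp_ne_zero hp σ) hb) (by decide)
  refine encard_arcIsolated_le_four_of_first_edge (a := a / b) (fun m => hc (σ m))
    (area_comp_ne_zero hp σ) ?_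
  rw [ha, hb, smul_smul, div_mul_cancel₀ _ hb0]

/-- Collinearity makes one exponent difference of `q` the multiple `r 2` of the other, so the second
term is the power `r 2` of the first; distinct exponents give `r 2 ≠ 0` and `r 2 ≠ 1`. -/
theorem encard_arcIsolated_le_four_of_segment (hc : ∀ i, c i ≠ 0) (hd : ∀ i, d i ≠ 0)
    (hp : area p ≠ 0) (hq : area q = 0) (hqinj : Function.Injective q) :
    (arcIsolated (posCommonZeros (tri c p) (tri d q))).encard ≤ 4 := by
  obtain ⟨r, hr0, hr1, hr, hqr⟩ := exists_smul_of_area_eq_zero hq hqinj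
  have h1 := eq_smul_add_smul hp (q 1 - q 0)
  set a := cross (q 1 - q 0) (p 2 - p 0) / cross (p 1 - p 0) (p 2 - p 0)
  set b := cross (p 1 - p 0) (q 1 - q 0) / cross (p 1 - p 0) (p 2 - p 0)
  have h2 : q 2 - q 0 = (a * r 2) • (p 1 - p 0) + (b * r 2) • (p 2 - p 0) := by
    rw [hqr 2, add_sub_cancel_left, h1, smul_add, smul_smul, smul_smul, mul_comm a, mul_comm b]
  refine encard_arcIsolated_le (n := 4) (hc 2) hp h1 h2 ?_
  have hs0 : r 2 ≠ 0 := hr0 ▸ hr.ne (by decide)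
  have hs1 : r 2 ≠ 1 := hr1 ▸ hr.ne (by decide)
  have hz := zerosLE_four_of_segment (-c 0 / c 2) (-c 1 / c 2) (d 0) (d 1) a b (hd 2) hs0 hs1
  refine ZerosLE.of_mul (k := fun _ => 1) (fun _ _ => one_ne_zero) (fun t ht => ?_) hz
  rw [one_mul, Real.mul_rpow (Real.rpow_pos_of_pos ht.1 _).le (Real.rpow_pos_of_pos ht.2 _).le,
    ← Real.rpow_mul ht.1.le, ← Real.rpow_mul ht.2.le]

theorem arcIsolated_eq_empty_of_parallel (hp : area p = 0) (hpinj : Function.Injective p)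
    (hq : area q = 0) (hqinj : Function.Injective q) (h : cross (p 1 - p 0) (q 1 - q 0) = 0) :
    arcIsolated (posCommonZeros (tri c p) (tri d q)) = ∅ := by
  obtain ⟨r, -, -, -, hpr⟩ := exists_smul_of_area_eq_zero hp hpinj
  obtain ⟨s, -, -, -, hqs⟩ := exists_smul_of_area_eq_zero hq hqinj
  refine arcIsolated_eq_empty (u := p 1 - p 0) (sub_ne_zero.2 (hpinj.ne (by decide)))
    (fun i => ?_) (fun i => ?_)
  · rw [hpr i, cross_add_right, cross_smul_right, cross_self_eq_zero, mul_zero, add_zero]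
  · rw [hqs i, cross_add_right, cross_smul_right, h, mul_zero, add_zero]

theorem encard_arcIsolated_le_four_of_segments (hc : ∀ i, c i ≠ 0) (hd : ∀ i, d i ≠ 0)
    (hp : area p = 0) (hpinj : Function.Injective p) (hq : area q = 0)
    (hqinj : Function.Injective q) :
    (arcIsolated (posCommonZeros (tri c p) (tri d q))).encard ≤ 4 := by
  by_cases h : cross (p 1 - p 0) (q 1 - q 0) = 0
  · rw [arcIsolated_eq_empty_of_parallel hp hpinj hq hqinj h, Set.encard_empty]
    exact zero_le
  obtain ⟨r, hr0, hr1, hr, hpr⟩ := exists_smul_of_area_eq_zero hp hpinj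
  obtain ⟨s, hs0, hs1, hs, hqs⟩ := exists_smul_of_area_eq_zero hq hqinj
  exact encard_arcIsolated_le_of_segments (hc 2) (hd 2) h rfl (sub_eq_iff_eq_add'.2 (hpr 2))
    (hr0 ▸ hr.ne (by decide)) (hr1 ▸ hr.ne (by decide)) rfl (sub_eq_iff_eq_add'.2 (hqs 2))
    (hs0 ▸ hs.ne (by decide)) (hs1 ▸ hs.ne (by decide))

theorem encard_exposedPairs_swap : (exposedPairs q p).encard = (exposedPairs p q).encard := by
  rw [← Prod.swap_injective.encard_image]
  congr 1
  ext ⟨i, j⟩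
  rw [← mem_exposedPairs_swap]
  exact ⟨by rintro ⟨⟨k, l⟩, hkl, h⟩; cases h; exact hkl, fun h => ⟨(j, i), h, rfl⟩⟩

/-- All configurations except parallel segments and homothetic triangles have at least four exposed
pairs. -/
theorem encard_arcIsolated_le_two (hc : ∀ i, c i ≠ 0) (hpinj : Function.Injective p)
    (hqinj : Function.Injective q) (h : (exposedPairs p q).encard ≤ 3) :
    (arcIsolated (posCommonZeros (tri c p) (tri d q))).encard ≤ 2 := by
  have h4 : ¬ 4 ≤ (exposedPairs p q).encard := fun h' => absurd (h'.trans h) (by norm_num)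
  by_cases hp : area p = 0 <;> by_cases hq : area q = 0
  · by_cases hpar : cross (p 1 - p 0) (q 1 - q 0) = 0
    · rw [arcIsolated_eq_empty_of_parallel hp hpinj hq hqinj hpar, Set.encard_empty]
      exact zero_le
    · exact absurd (four_le_encard_exposedPairs_of_segments hp hpinj hq hqinj hpar) h4
  · rw [← encard_exposedPairs_swap] at h4
    exact absurd (four_le_encard_exposedPairs_of_segment hq hp hpinj) h4
  · exact absurd (four_le_encard_exposedPairs_of_segment hp hq hqinj) h4
  · by_cases hn : ∃ i j, IsStrictMax (normal p i) q j
    · obtain ⟨i, j, hij⟩ := hn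
      exact absurd (four_le_encard_exposedPairs hp hq hij) h4
    · obtain ⟨σ, l, h1, h2⟩ := exists_homothety hp hq (not_exists.1 hn)
      exact encard_arcIsolated_le_two_of_homothety hc hp h1 h2

/-- Two triangles with at most five exposed pairs have a common outer normal. It may come from
either triangle, and the symmetry of the system covers both cases. -/
theorem encard_arcIsolated_le_four (hc : ∀ i, c i ≠ 0) (hd : ∀ i, d i ≠ 0)
    (hpinj : Function.Injective p) (hqinj : Function.Injective q)
    (h : (exposedPairs p q).encard ≤ 5) :
    (arcIsolated (posCommonZeros (tri c p) (tri d q))).encard ≤ 4 := by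
  by_cases hp : area p = 0 <;> by_cases hq : area q = 0
  · exact encard_arcIsolated_le_four_of_segments hc hd hp hpinj hq hqinj
  · rw [posCommonZeros_comm]
    exact encard_arcIsolated_le_four_of_segment hd hc hq hp hpinj
  · exact encard_arcIsolated_le_four_of_segment hc hd hp hq hqinj
  · by_cases h1 : ∀ i, ∃ j, IsStrictMax (normal p i) q j
    · by_cases h2 : ∀ j, ∃ i, IsStrictMax (normal q j) p i
      · exact absurd ((six_le_encard_exposedPairs hp hq h1 h2).trans h) (by norm_num)
      · obtain ⟨i, hi⟩ := not_forall.1 h2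
        obtain ⟨j, k, hjk, heq, -⟩ := exists_eq_max_of_not_isStrictMax hi
        rw [posCommonZeros_comm]
        exact encard_arcIsolated_le_four_of_edge hd hq hjk heq
    · obtain ⟨i, hi⟩ := not_forall.1 h1
      obtain ⟨j, k, hjk, heq, -⟩ := exists_eq_max_of_not_isStrictMax hi
      exact encard_arcIsolated_le_four_of_edge hc hp hjk heq

end Bounds

/-- A pair of families whose sum lies on a segment is contained in two parallel lines. -/
theorem cross_eq_of_add_mem_segment {ι κ : Type*} [Nonempty ι] [Nonempty κ]
    {p : ι → Fin 2 → ℝ} {q : κ → Fin 2 → ℝ} {x y : Fin 2 → ℝ}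
    (h : convexHull ℝ (Set.range p) + convexHull ℝ (Set.range q) = segment ℝ x y) :
    (∀ i k, cross (y - x) (p i) = cross (y - x) (p k)) ∧
      ∀ j l, cross (y - x) (q j) = cross (y - x) (q l) := by
  have key : ∀ i j, cross (y - x) (p i) + cross (y - x) (q j) = cross (y - x) x := by
    intro i j
    have hm : p i + q j ∈ segment ℝ x y := by
      rw [← h]
      exact Set.add_mem_add (subset_convexHull _ _ ⟨i, rfl⟩) (subset_convexHull _ _ ⟨j, rfl⟩)
    rw [segment_eq_image'] at hm
    obtain ⟨t, -, ht⟩ := hm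
    rw [← cross_add_right, ← ht, cross_add_right, cross_smul_right, cross_self_eq_zero, mul_zero,
      add_zero]
  obtain ⟨i₀⟩ := ‹Nonempty ι›
  obtain ⟨j₀⟩ := ‹Nonempty κ›
  exact ⟨fun i k => add_right_cancel ((key i j₀).trans (key k j₀).symm),
    fun j l => add_left_cancel ((key i₀ j).trans (key i₀ l).symm)⟩

theorem isolatedPosZeros_bounds (F : FewnomialSystem 2 2) (hF : F.IsOfType ![3, 3]) :
    (IsLineSegment F.polygon → F.isolatedPosZeros = ∅) ∧
      (IsConvexPolygon 3 F.polygon → F.isolatedPosZeros.encard ≤ 2) ∧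
      (∀ l : ℕ, l = 4 ∨ l = 5 → IsConvexPolygon l F.polygon →
        F.isolatedPosZeros.encard ≤ 4) := by
  obtain ⟨c, p, hc, hpinj, hps, hpe⟩ := exists_tri (hF 0)
  obtain ⟨d, q, hd, hqinj, hqs, hqe⟩ := exists_tri (hF 1)
  have hP : F.polygon = convexHull ℝ (Set.range p) + convexHull ℝ (Set.range q) := by
    rw [FewnomialSystem.polygon, Fewnomial.newt, Fewnomial.newt, hps, hqs]
  have hE := encard_exposedPairs_le p q
  rw [isolatedPosZeros_eq hpe hqe, hP]
  refine ⟨?_, ?_, ?_⟩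
  · rintro ⟨x, y, hxy, h⟩
    obtain ⟨h1, h2⟩ := cross_eq_of_add_mem_segment h
    exact arcIsolated_eq_empty (sub_ne_zero.2 hxy.symm) (fun i => h1 i 0) fun i => h2 i 0
  · rintro ⟨-, h, -⟩
    exact encard_arcIsolated_le_two hc hpinj hqinj (hE.trans h.le)
  · rintro l hl ⟨-, h, -⟩
    refine encard_arcIsolated_le_four hc hd hpinj hqinj (hE.trans (h.le.trans ?_))
    rcases hl with rfl | rfl <;> norm_num

/-! ### Explicit trinomials and the sharp examples -/

theorem supp_trinomial {n : ℕ} {c₁ c₂ c₃ : ℝ} {a₁ a₂ a₃ : Fin n → ℝ} (h₁ : c₁ ≠ 0) (h₂ : c₂ ≠ 0)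
    (h₃ : c₃ ≠ 0) (h₁₂ : a₁ ≠ a₂) (h₁₃ : a₁ ≠ a₃) (h₂₃ : a₂ ≠ a₃) :
    (Fewnomial.term c₁ a₁ + Fewnomial.term c₂ a₂ + Fewnomial.term c₃ a₃).supp = {a₁, a₂, a₃} := by
  classical
  ext a
  simp only [Fewnomial.supp, Fewnomial.term, Finsupp.mem_support_iff, AddMonoidAlgebra.coeff_add,
    AddMonoidAlgebra.coeff_single, Finsupp.add_apply, Finsupp.single_apply, Finset.mem_insert,
    Finset.mem_singleton]
  by_cases e1 : a₁ = a
  · subst e1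
    simp [h₁, h₁₂.symm, h₁₃.symm]
  by_cases e2 : a₂ = a
  · subst e2
    simp [h₂, h₁₂, h₂₃.symm]
  by_cases e3 : a₃ = a
  · subst e3
    simp [h₃, h₁₃, h₂₃]
  simp [e1, e2, e3, Ne.symm e1, Ne.symm e2, Ne.symm e3]

theorem eval_trinomial {n : ℕ} {c₁ c₂ c₃ : ℝ} {a₁ a₂ a₃ : Fin n → ℝ} (h₁ : c₁ ≠ 0) (h₂ : c₂ ≠ 0)
    (h₃ : c₃ ≠ 0) (h₁₂ : a₁ ≠ a₂) (h₁₃ : a₁ ≠ a₃) (h₂₃ : a₂ ≠ a₃) (x : Fin n → ℝ) :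
    (Fewnomial.term c₁ a₁ + Fewnomial.term c₂ a₂ + Fewnomial.term c₃ a₃).eval x =
      c₁ * ∏ i, x i ^ a₁ i + c₂ * ∏ i, x i ^ a₂ i + c₃ * ∏ i, x i ^ a₃ i := by
  rw [Fewnomial.eval, supp_trinomial h₁ h₂ h₃ h₁₂ h₁₃ h₂₃,
    Finset.sum_insert (by simp [h₁₂, h₁₃]), Finset.sum_insert (by simp [h₂₃]),
    Finset.sum_singleton]
  simp [Fewnomial.term, h₁₂, h₁₃, h₂₃, h₁₂.symm, h₁₃.symm, h₂₃.symm, add_assoc]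

theorem card_supp_trinomial {n : ℕ} {c₁ c₂ c₃ : ℝ} {a₁ a₂ a₃ : Fin n → ℝ} (h₁ : c₁ ≠ 0)
    (h₂ : c₂ ≠ 0) (h₃ : c₃ ≠ 0) (h₁₂ : a₁ ≠ a₂) (h₁₃ : a₁ ≠ a₃) (h₂₃ : a₂ ≠ a₃) :
    (Fewnomial.term c₁ a₁ + Fewnomial.term c₂ a₂ + Fewnomial.term c₃ a₃).supp.card = 3 := by
  rw [supp_trinomial h₁ h₂ h₃ h₁₂ h₁₃ h₂₃, Finset.card_eq_three]
  exact ⟨_, _, _, h₁₂, h₁₃, h₂₃, rfl⟩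

theorem IsArc.isPreconnected {X : Type*} [TopologicalSpace X] {S : Set X} (h : IsArc S) :
    IsPreconnected S := by
  rw [isPreconnected_iff_preconnectedSpace]
  rcases h with ⟨⟨e⟩⟩ | ⟨I, hI, ⟨e⟩⟩
  · have : PreconnectedSpace Circle := by
      have hrange : Set.range Circle.exp = Set.univ :=
        Set.range_eq_univ.2 fun z => ⟨Complex.arg z, Circle.exp_arg z⟩
      exact ⟨hrange ▸ isPreconnected_range Circle.exp.continuous⟩
    exact e.surjective.denseRange.preconnectedSpace e.continuous
  · have : PreconnectedSpace I := Subtype.preconnectedSpace hI.isPreconnected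
    exact e.surjective.denseRange.preconnectedSpace e.continuous

/-- Arcs are connected and a finite set is totally disconnected, so an arc of roots is a single
point. -/
theorem isolatedPosZeros_of_finite {k n : ℕ} {F : FewnomialSystem k n} (h : F.posZeros.Finite) :
    F.isolatedPosZeros = F.posZeros := by
  ext z
  refine ⟨fun hz => hz.1, fun hz => ⟨hz, fun S hS hSF hzS => ?_⟩⟩
  have hsub : S.Subsingleton :=
    (h.subset hSF).countable.isTotallyDisconnected S subset_rfl hS.isPreconnected
  exact hsub.eq_singleton_of_mem hzS

theorem isConvexPolygon_of_isStrictMax {l : ℕ} (hl : 3 ≤ l) {A B : Set (Fin 2 → ℝ)}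
    {V : Fin l → Fin 2 → ℝ} (hV : ∀ i, V i ∈ A + B)
    (hAB : ∀ a ∈ A, ∀ b ∈ B, a + b ∈ convexHull ℝ (Set.range V))
    (hw : ∀ i, ∃ w, IsStrictMax w V i) :
    IsConvexPolygon l (convexHull ℝ A + convexHull ℝ B) := by
  have hP : convexHull ℝ A + convexHull ℝ B = convexHull ℝ (Set.range V) := by
    rw [← convexHull_add]
    refine (convexHull_min ?_ (convex_convexHull _ _)).antisymm (convexHull_mono ?_)
    · rintro _ ⟨a, ha, b, hb, rfl⟩
      exact hAB a ha b hb
    · rintro _ ⟨i, rfl⟩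
      exact hV i
  have hext : (convexHull ℝ (Set.range V)).extremePoints ℝ = Set.range V := by
    refine extremePoints_convexHull_subset.antisymm ?_
    rintro _ ⟨i, rfl⟩
    obtain ⟨w, hw⟩ := hw i
    -- The one-point family at the origin reduces vertices of a hull to vertices of a sum.
    have := add_mem_extremePoints (q := fun _ : Unit => (0 : Fin 2 → ℝ)) (j := ()) hw
      fun k hk => absurd rfl hk
    simpa using this
  have hinj : Function.Injective V := by
    intro i k hik
    by_contra hne
    obtain ⟨w, hw⟩ := hw i
    have := hw k (Ne.symm hne)
    rw [hik] at this
    exact lt_irrefl _ this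
  rw [hP]
  refine ⟨hl, ?_, by rw [hext]⟩
  rw [hext, ← Set.image_univ, hinj.encard_image, Set.encard_univ]
  simp

theorem mem_convexHull_range {ι : Type*} {V : ι → Fin 2 → ℝ} {a b c d : ℝ} (i k : ι) (t : ℝ)
    (hi : V i = ![a, b]) (hk : V k = ![c, d]) (h0 : 0 ≤ t) (h1 : t ≤ 1) {x : Fin 2 → ℝ}
    (hx0 : x 0 = (1 - t) * a + t * c) (hx1 : x 1 = (1 - t) * b + t * d) :
    x ∈ convexHull ℝ (Set.range V) := by
  have hx : x = (1 - t) • V i + t • V k := by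
    rw [hi, hk]
    ext j
    fin_cases j
    exacts [hx0, hx1]
  have hmem : ∀ m, V m ∈ convexHull ℝ (Set.range V) := fun m => subset_convexHull _ _ ⟨m, rfl⟩
  rw [hx]
  exact convex_convexHull ℝ (Set.range V) (hmem i) (hmem k) (sub_nonneg.2 h1) h0
    (sub_add_cancel _ _)

theorem vec_ne_of_fst {a b c d : ℝ} (h : a ≠ c) : ![a, b] ≠ ![c, d] := fun e => h (congrFun e 0)

theorem vec_ne_of_snd {a b c d : ℝ} (h : b ≠ d) : ![a, b] ≠ ![c, d] := fun e => h (congrFun e 1)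

theorem polygon_trinomials {c₁ c₂ c₃ d₁ d₂ d₃ : ℝ} {a₁ a₂ a₃ b₁ b₂ b₃ : Fin 2 → ℝ}
    (h : (Fewnomial.term c₁ a₁ + Fewnomial.term c₂ a₂ + Fewnomial.term c₃ a₃).supp = {a₁, a₂, a₃})
    (h' : (Fewnomial.term d₁ b₁ + Fewnomial.term d₂ b₂ + Fewnomial.term d₃ b₃).supp =
      {b₁, b₂, b₃}) :
    FewnomialSystem.polygon ![.term c₁ a₁ + .term c₂ a₂ + .term c₃ a₃,
      .term d₁ b₁ + .term d₂ b₂ + .term d₃ b₃] =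
      convexHull ℝ {a₁, a₂, a₃} + convexHull ℝ {b₁, b₂, b₃} := by
  simp only [FewnomialSystem.polygon, Fewnomial.newt, Matrix.cons_val_zero, Matrix.cons_val_one,
    h, h', Finset.coe_insert, Finset.coe_singleton]

theorem sharp_triangle :
    ∃ F : FewnomialSystem 2 2,
      F = ![.term 1 ![2, 0] + .term 1 ![0, 2] + .term (-25) ![0, 0],
            .term 1 ![1, 0] + .term 1 ![0, 1] + .term (-7) ![0, 0]] ∧
      F.IsOfType ![3, 3] ∧ IsConvexPolygon 3 F.polygon ∧ F.isolatedPosZeros.encard = 2 := by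
  have n1 : (![2, 0] : Fin 2 → ℝ) ≠ ![0, 2] := vec_ne_of_fst (by norm_num)
  have n2 : (![2, 0] : Fin 2 → ℝ) ≠ ![0, 0] := vec_ne_of_fst (by norm_num)
  have n3 : (![0, 2] : Fin 2 → ℝ) ≠ ![0, 0] := vec_ne_of_snd (by norm_num)
  have m1 : (![1, 0] : Fin 2 → ℝ) ≠ ![0, 1] := vec_ne_of_fst (by norm_num)
  have m2 : (![1, 0] : Fin 2 → ℝ) ≠ ![0, 0] := vec_ne_of_fst (by norm_num)
  have m3 : (![0, 1] : Fin 2 → ℝ) ≠ ![0, 0] := vec_ne_of_snd (by norm_num)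
  have k1 : (1 : ℝ) ≠ 0 := one_ne_zero
  have k2 : (-25 : ℝ) ≠ 0 := by norm_num
  have k3 : (-7 : ℝ) ≠ 0 := by norm_num
  refine ⟨_, rfl, ?_, ?_, ?_⟩
  · exact Fin.forall_fin_two.2 ⟨card_supp_trinomial k1 k1 k2 n1 n2 n3,
      card_supp_trinomial k1 k1 k3 m1 m2 m3⟩
  · rw [polygon_trinomials (supp_trinomial k1 k1 k2 n1 n2 n3) (supp_trinomial k1 k1 k3 m1 m2 m3)]
    refine isConvexPolygon_of_isStrictMax le_rfl (V := ![![0, 0], ![3, 0], ![0, 3]]) ?_ ?_ ?_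
    · intro i
      fin_cases i
      · exact ⟨![0, 0], by simp, ![0, 0], by simp, by simp⟩
      · exact ⟨![2, 0], by simp, ![1, 0], by simp, by norm_num⟩
      · exact ⟨![0, 2], by simp, ![0, 1], by simp, by norm_num⟩
    -- Each of the nine sums of exponents lies on a segment between two listed vertices, at the
    -- parameter supplied.
    · rintro a (rfl | rfl | rfl) b (rfl | rfl | rfl)
      · refine mem_convexHull_range 0 1 1 rfl rfl ?_ ?_ ?_ ?_ <;> norm_num
      · refine mem_convexHull_range 1 2 (1 / 3) rfl rfl ?_ ?_ ?_ ?_ <;> norm_num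
      · refine mem_convexHull_range 0 1 (2 / 3) rfl rfl ?_ ?_ ?_ ?_ <;> norm_num
      · refine mem_convexHull_range 1 2 (2 / 3) rfl rfl ?_ ?_ ?_ ?_ <;> norm_num
      · refine mem_convexHull_range 0 2 1 rfl rfl ?_ ?_ ?_ ?_ <;> norm_num
      · refine mem_convexHull_range 0 2 (2 / 3) rfl rfl ?_ ?_ ?_ ?_ <;> norm_num
      · refine mem_convexHull_range 0 1 (1 / 3) rfl rfl ?_ ?_ ?_ ?_ <;> norm_num
      · refine mem_convexHull_range 0 2 (1 / 3) rfl rfl ?_ ?_ ?_ ?_ <;> norm_num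
      · refine mem_convexHull_range 0 1 0 rfl rfl ?_ ?_ ?_ ?_ <;> norm_num
    · intro i
      fin_cases i
      · refine ⟨![-1, 1], fun k hk => ?_⟩
        fin_cases k <;> first | exact absurd rfl hk | norm_num [cross]
      · refine ⟨![0, -1], fun k hk => ?_⟩
        fin_cases k <;> first | exact absurd rfl hk | norm_num [cross]
      · refine ⟨![1, 0], fun k hk => ?_⟩
        fin_cases k <;> first | exact absurd rfl hk | norm_num [cross]
  · have hZ : FewnomialSystem.posZeros ![.term 1 ![2, 0] + .term 1 ![0, 2] + .term (-25) ![0, 0],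
        .term 1 ![1, 0] + .term 1 ![0, 1] + .term (-7) ![0, 0]] =
        ({![3, 4], ![4, 3]} : Set (Fin 2 → ℝ)) := by
      ext x
      simp only [FewnomialSystem.posZeros, Set.mem_ofPred_eq, Fin.forall_fin_two,
        Matrix.cons_val_zero, Matrix.cons_val_one, eval_trinomial k1 k1 k2 n1 n2 n3,
        eval_trinomial k1 k1 k3 m1 m2 m3, Fin.prod_univ_two, Real.rpow_zero, Real.rpow_one,
        Real.rpow_two, Set.mem_insert_iff, Set.mem_singleton_iff, funext_iff]
      constructor
      · rintro ⟨-, h1, h2⟩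
        have hy : x 1 = 7 - x 0 := by linarith
        rw [hy] at h1 ⊢
        -- Substituting the line into the circle gives twice this product.
        have : (x 0 - 3) * (x 0 - 4) = 0 := by nlinarith
        rcases mul_eq_zero.1 this with h | h
        · left
          constructor <;> linarith
        · right
          constructor <;> linarith
      · rintro (⟨h1, h2⟩ | ⟨h1, h2⟩) <;> rw [h1, h2] <;> norm_num
    rw [isolatedPosZeros_of_finite (hZ ▸ Set.toFinite _), hZ]
    exact Set.encard_pair (vec_ne_of_fst (by norm_num))

theorem encard_four {α : Type*} {a b c d : α} (hab : a ≠ b) (hac : a ≠ c) (had : a ≠ d)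
    (hbc : b ≠ c) (hbd : b ≠ d) (hcd : c ≠ d) : ({a, b, c, d} : Set α).encard = 4 := by
  rw [Set.encard_insert_of_notMem (by simp [hab, hac, had]),
    Set.encard_insert_of_notMem (by simp [hbc, hbd]), Set.encard_pair hcd]
  norm_num

theorem sharp_quadrilateral :
    ∃ F : FewnomialSystem 2 2,
      F = ![.term 1 ![2, 0] + .term (-3) ![1, 0] + .term 2 ![0, 0],
            .term 1 ![0, 2] + .term (-3) ![0, 1] + .term 2 ![0, 0]] ∧
      F.IsOfType ![3, 3] ∧ IsConvexPolygon 4 F.polygon ∧ F.isolatedPosZeros.encard = 4 := by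
  have n1 : (![2, 0] : Fin 2 → ℝ) ≠ ![1, 0] := vec_ne_of_fst (by norm_num)
  have n2 : (![2, 0] : Fin 2 → ℝ) ≠ ![0, 0] := vec_ne_of_fst (by norm_num)
  have n3 : (![1, 0] : Fin 2 → ℝ) ≠ ![0, 0] := vec_ne_of_fst (by norm_num)
  have m1 : (![0, 2] : Fin 2 → ℝ) ≠ ![0, 1] := vec_ne_of_snd (by norm_num)
  have m2 : (![0, 2] : Fin 2 → ℝ) ≠ ![0, 0] := vec_ne_of_snd (by norm_num)
  have m3 : (![0, 1] : Fin 2 → ℝ) ≠ ![0, 0] := vec_ne_of_snd (by norm_num)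
  have k1 : (1 : ℝ) ≠ 0 := one_ne_zero
  have k2 : (-3 : ℝ) ≠ 0 := by norm_num
  have k3 : (2 : ℝ) ≠ 0 := by norm_num
  refine ⟨_, rfl, ?_, ?_, ?_⟩
  · exact Fin.forall_fin_two.2 ⟨card_supp_trinomial k1 k2 k3 n1 n2 n3,
      card_supp_trinomial k1 k2 k3 m1 m2 m3⟩
  · rw [polygon_trinomials (supp_trinomial k1 k2 k3 n1 n2 n3) (supp_trinomial k1 k2 k3 m1 m2 m3)]
    refine isConvexPolygon_of_isStrictMax (by norm_num)
      (V := ![![0, 0], ![2, 0], ![2, 2], ![0, 2]]) ?_ ?_ ?_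
    · intro i
      fin_cases i
      · exact ⟨![0, 0], by simp, ![0, 0], by simp, by simp⟩
      · exact ⟨![2, 0], by simp, ![0, 0], by simp, by simp⟩
      · exact ⟨![2, 0], by simp, ![0, 2], by simp, by simp⟩
      · exact ⟨![0, 0], by simp, ![0, 2], by simp, by simp⟩
    · rintro a (rfl | rfl | rfl) b (rfl | rfl | rfl)
      · refine mem_convexHull_range 2 2 0 rfl rfl ?_ ?_ ?_ ?_ <;> norm_num
      · refine mem_convexHull_range 1 2 (1 / 2) rfl rfl ?_ ?_ ?_ ?_ <;> norm_num
      · refine mem_convexHull_range 1 1 0 rfl rfl ?_ ?_ ?_ ?_ <;> norm_num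
      · refine mem_convexHull_range 2 3 (1 / 2) rfl rfl ?_ ?_ ?_ ?_ <;> norm_num
      · refine mem_convexHull_range 0 2 (1 / 2) rfl rfl ?_ ?_ ?_ ?_ <;> norm_num
      · refine mem_convexHull_range 0 1 (1 / 2) rfl rfl ?_ ?_ ?_ ?_ <;> norm_num
      · refine mem_convexHull_range 3 3 0 rfl rfl ?_ ?_ ?_ ?_ <;> norm_num
      · refine mem_convexHull_range 0 3 (1 / 2) rfl rfl ?_ ?_ ?_ ?_ <;> norm_num
      · refine mem_convexHull_range 0 0 0 rfl rfl ?_ ?_ ?_ ?_ <;> norm_num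
    · intro i
      fin_cases i
      · refine ⟨![-1, 1], fun k hk => ?_⟩
        fin_cases k <;> first | exact absurd rfl hk | norm_num [cross]
      · refine ⟨![-1, -1], fun k hk => ?_⟩
        fin_cases k <;> first | exact absurd rfl hk | norm_num [cross]
      · refine ⟨![1, -1], fun k hk => ?_⟩
        fin_cases k <;> first | exact absurd rfl hk | norm_num [cross]
      · refine ⟨![1, 1], fun k hk => ?_⟩
        fin_cases k <;> first | exact absurd rfl hk | norm_num [cross]
  · have hZ : FewnomialSystem.posZeros ![.term 1 ![2, 0] + .term (-3) ![1, 0] + .term 2 ![0, 0],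
        .term 1 ![0, 2] + .term (-3) ![0, 1] + .term 2 ![0, 0]] =
        ({![1, 1], ![1, 2], ![2, 1], ![2, 2]} : Set (Fin 2 → ℝ)) := by
      ext x
      simp only [FewnomialSystem.posZeros, Set.mem_ofPred_eq, Fin.forall_fin_two,
        Matrix.cons_val_zero, Matrix.cons_val_one, eval_trinomial k1 k2 k3 n1 n2 n3,
        eval_trinomial k1 k2 k3 m1 m2 m3, Fin.prod_univ_two, Real.rpow_zero, Real.rpow_one,
        Real.rpow_two, Set.mem_insert_iff, Set.mem_singleton_iff, funext_iff]
      constructor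
      · rintro ⟨-, h1, h2⟩
        have e1 : (x 0 - 1) * (x 0 - 2) = 0 := by linarith
        have e2 : (x 1 - 1) * (x 1 - 2) = 0 := by linarith
        rw [mul_eq_zero, sub_eq_zero, sub_eq_zero] at e1 e2
        tauto
      · rintro (⟨h1, h2⟩ | ⟨h1, h2⟩ | ⟨h1, h2⟩ | ⟨h1, h2⟩) <;> rw [h1, h2] <;> norm_num
    rw [isolatedPosZeros_of_finite (hZ ▸ Set.toFinite _), hZ]
    exact encard_four (vec_ne_of_snd (by norm_num)) (vec_ne_of_fst (by norm_num))
      (vec_ne_of_fst (by norm_num)) (vec_ne_of_fst (by norm_num)) (vec_ne_of_fst (by norm_num))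
      (vec_ne_of_snd (by norm_num))

theorem sharp_pentagon :
    ∃ F : FewnomialSystem 2 2,
      F = ![.term 1 ![0, 2] + .term (-7) ![0, 1] + .term 12 ![0, 0],
            .term (-1) ![0, 0] + .term 1 ![1, 1] + .term (-1) ![2, 0]] ∧
      F.IsOfType ![3, 3] ∧ IsConvexPolygon 5 F.polygon ∧ F.isolatedPosZeros.encard = 4 := by
  have n1 : (![0, 2] : Fin 2 → ℝ) ≠ ![0, 1] := vec_ne_of_snd (by norm_num)
  have n2 : (![0, 2] : Fin 2 → ℝ) ≠ ![0, 0] := vec_ne_of_snd (by norm_num)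
  have n3 : (![0, 1] : Fin 2 → ℝ) ≠ ![0, 0] := vec_ne_of_snd (by norm_num)
  have m1 : (![0, 0] : Fin 2 → ℝ) ≠ ![1, 1] := vec_ne_of_fst (by norm_num)
  have m2 : (![0, 0] : Fin 2 → ℝ) ≠ ![2, 0] := vec_ne_of_fst (by norm_num)
  have m3 : (![1, 1] : Fin 2 → ℝ) ≠ ![2, 0] := vec_ne_of_fst (by norm_num)
  have k1 : (1 : ℝ) ≠ 0 := one_ne_zero
  have k2 : (-7 : ℝ) ≠ 0 := by norm_num
  have k3 : (12 : ℝ) ≠ 0 := by norm_num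
  have k4 : (-1 : ℝ) ≠ 0 := by norm_num
  refine ⟨_, rfl, ?_, ?_, ?_⟩
  · exact Fin.forall_fin_two.2 ⟨card_supp_trinomial k1 k2 k3 n1 n2 n3,
      card_supp_trinomial k4 k1 k4 m1 m2 m3⟩
  · rw [polygon_trinomials (supp_trinomial k1 k2 k3 n1 n2 n3) (supp_trinomial k4 k1 k4 m1 m2 m3)]
    refine isConvexPolygon_of_isStrictMax (by norm_num)
      (V := ![![0, 0], ![2, 0], ![2, 2], ![1, 3], ![0, 2]]) ?_ ?_ ?_
    · intro i
      fin_cases i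
      · exact ⟨![0, 0], by simp, ![0, 0], by simp, by simp⟩
      · exact ⟨![0, 0], by simp, ![2, 0], by simp, by simp⟩
      · exact ⟨![0, 2], by simp, ![2, 0], by simp, by simp⟩
      · exact ⟨![0, 2], by simp, ![1, 1], by simp, by norm_num⟩
      · exact ⟨![0, 2], by simp, ![0, 0], by simp, by simp⟩
    · rintro a (rfl | rfl | rfl) b (rfl | rfl | rfl)
      · refine mem_convexHull_range 4 4 0 rfl rfl ?_ ?_ ?_ ?_ <;> norm_num
      · refine mem_convexHull_range 3 3 0 rfl rfl ?_ ?_ ?_ ?_ <;> norm_num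
      · refine mem_convexHull_range 2 2 0 rfl rfl ?_ ?_ ?_ ?_ <;> norm_num
      · refine mem_convexHull_range 0 4 (1 / 2) rfl rfl ?_ ?_ ?_ ?_ <;> norm_num
      · refine mem_convexHull_range 2 4 (1 / 2) rfl rfl ?_ ?_ ?_ ?_ <;> norm_num
      · refine mem_convexHull_range 1 2 (1 / 2) rfl rfl ?_ ?_ ?_ ?_ <;> norm_num
      · refine mem_convexHull_range 0 0 0 rfl rfl ?_ ?_ ?_ ?_ <;> norm_num
      · refine mem_convexHull_range 0 2 (1 / 2) rfl rfl ?_ ?_ ?_ ?_ <;> norm_num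
      · refine mem_convexHull_range 1 1 0 rfl rfl ?_ ?_ ?_ ?_ <;> norm_num
    · intro i
      fin_cases i
      · refine ⟨![-1, 1], fun k hk => ?_⟩
        fin_cases k <;> first | exact absurd rfl hk | norm_num [cross]
      · refine ⟨![-1, -1], fun k hk => ?_⟩
        fin_cases k <;> first | exact absurd rfl hk | norm_num [cross]
      · refine ⟨![1, -2], fun k hk => ?_⟩
        fin_cases k <;> first | exact absurd rfl hk | norm_num [cross]
      · refine ⟨![1, 0], fun k hk => ?_⟩
        fin_cases k <;> first | exact absurd rfl hk | norm_num [cross]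
      · refine ⟨![1, 2], fun k hk => ?_⟩
        fin_cases k <;> first | exact absurd rfl hk | norm_num [cross]
  -- For `y = 3` and `y = 4` the second equation becomes `x² - 3x + 1 = 0` and `x² - 4x + 1 = 0`;
  -- the bounds on the square roots make all four solutions positive.
  · have s3 : √3 ^ 2 = 3 := Real.sq_sqrt (by norm_num)
    have s5 : √5 ^ 2 = 5 := Real.sq_sqrt (by norm_num)
    have p3 : 0 < √3 := Real.sqrt_pos.2 (by norm_num)
    have p5 : 0 < √5 := Real.sqrt_pos.2 (by norm_num)
    have l3 : √3 < 2 := by nlinarith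
    have l5 : √5 < 3 := by nlinarith
    have hZ : FewnomialSystem.posZeros ![.term 1 ![0, 2] + .term (-7) ![0, 1] + .term 12 ![0, 0],
        .term (-1) ![0, 0] + .term 1 ![1, 1] + .term (-1) ![2, 0]] =
        ({![(3 - √5) / 2, 3], ![(3 + √5) / 2, 3], ![2 - √3, 4], ![2 + √3, 4]} :
          Set (Fin 2 → ℝ)) := by
      ext x
      simp only [FewnomialSystem.posZeros, Set.mem_ofPred_eq, Fin.forall_fin_two,
        Matrix.cons_val_zero, Matrix.cons_val_one, eval_trinomial k1 k2 k3 n1 n2 n3,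
        eval_trinomial k4 k1 k4 m1 m2 m3, Fin.prod_univ_two, Real.rpow_zero, Real.rpow_one,
        Real.rpow_two, Set.mem_insert_iff, Set.mem_singleton_iff, funext_iff]
      constructor
      · rintro ⟨-, h1, h2⟩
        have e1 : (x 1 - 3) * (x 1 - 4) = 0 := by linarith
        rw [mul_eq_zero, sub_eq_zero, sub_eq_zero] at e1
        rcases e1 with h | h <;> rw [h] at h2
        · have e2 : (x 0 - (3 - √5) / 2) * (x 0 - (3 + √5) / 2) = 0 := by nlinarith
          rw [mul_eq_zero, sub_eq_zero, sub_eq_zero] at e2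
          tauto
        · have e2 : (x 0 - (2 - √3)) * (x 0 - (2 + √3)) = 0 := by nlinarith
          rw [mul_eq_zero, sub_eq_zero, sub_eq_zero] at e2
          tauto
      · rintro (⟨h1, h2⟩ | ⟨h1, h2⟩ | ⟨h1, h2⟩ | ⟨h1, h2⟩) <;> rw [h1, h2] <;>
          refine ⟨⟨by linarith, by norm_num⟩, by norm_num, by nlinarith⟩
    rw [isolatedPosZeros_of_finite (hZ ▸ Set.toFinite _), hZ]
    refine encard_four (vec_ne_of_fst ?_) (vec_ne_of_snd ?_) (vec_ne_of_snd ?_)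
      (vec_ne_of_snd ?_) (vec_ne_of_snd ?_) (vec_ne_of_fst ?_)
    · exact (by linarith : (3 - √5) / 2 < (3 + √5) / 2).ne
    any_goals norm_num
    exact (by linarith : 2 - √3 < 2 + √3).ne

end

theorem corollary1 :
    -- upper bounds for all pairs of bivariate trinomials
    (∀ F : FewnomialSystem 2 2, F.IsOfType ![3, 3] →
      (IsLineSegment F.polygon → F.isolatedPosZeros = ∅) ∧
      (IsConvexPolygon 3 F.polygon → F.isolatedPosZeros.encard ≤ 2) ∧
      (∀ l : ℕ, l = 4 ∨ l = 5 → IsConvexPolygon l F.polygon → F.isolatedPosZeros.encard ≤ 4)) ∧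
    -- sharpness for triangles: `(x² + y² - 25, x + y - 7)`
    (∃ F : FewnomialSystem 2 2,
      F = ![.term 1 ![2, 0] + .term 1 ![0, 2] + .term (-25) ![0, 0],
            .term 1 ![1, 0] + .term 1 ![0, 1] + .term (-7) ![0, 0]] ∧
      F.IsOfType ![3, 3] ∧ IsConvexPolygon 3 F.polygon ∧ F.isolatedPosZeros.encard = 2) ∧
    -- sharpness for quadrilaterals: `(x² - 3x + 2, y² - 3y + 2)`
    (∃ F : FewnomialSystem 2 2,
      F = ![.term 1 ![2, 0] + .term (-3) ![1, 0] + .term 2 ![0, 0],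
            .term 1 ![0, 2] + .term (-3) ![0, 1] + .term 2 ![0, 0]] ∧
      F.IsOfType ![3, 3] ∧ IsConvexPolygon 4 F.polygon ∧ F.isolatedPosZeros.encard = 4) ∧
    -- sharpness for pentagons: `(y² - 7y + 12, -1 + xy - x²)`
    (∃ F : FewnomialSystem 2 2,
      F = ![.term 1 ![0, 2] + .term (-7) ![0, 1] + .term 12 ![0, 0],
            .term (-1) ![0, 0] + .term 1 ![1, 1] + .term (-1) ![2, 0]] ∧
      F.IsOfType ![3, 3] ∧ IsConvexPolygon 5 F.polygon ∧ F.isolatedPosZeros.encard = 4) := by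
  exact ⟨isolatedPosZeros_bounds, sharp_triangle, sharp_quadrilateral, sharp_pentagon⟩
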